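/- **Setting.** For real-valued $V_0,W\in L^\infty(\mathbb R)$, $\alpha,\lambda\in\mathbb R$ and $k\in\mathbb N=\{1,2,\dots\}$ consider in $L^2(\mathbb R)$ the operators $$L_{0,\lambda}^k=-\frac{d^2}{dy^2}+k^2\bigl(1-\lambda V_0(y)-W(y)\bigr),\qquad D(L_{0,\lambda}^k)=H^2(\mathbb R),$$ $$L_\lambda^k=-\frac{d^2}{dy^2}+k^2\bigl(1-\lambda V_0(y)-W(y)-\alpha\delta_0(y)\bigr),\qquad D(L_\lambda^k)=\{\phi\in H^1(\mathbb R)\cap H^2(\mathbb R\setminus\{0\}) : \phi'(0+)-\phi'(0-)=-k^2\alpha\,\phi(0)\},$$ where $L_\lambda^k\phi=-\phi''+k^2(1-\lambda V_0-W)\phi$ on $\mathbb R\setminus\{0\}$; $\rho(L)$ is the set of $\mu\in\mathbb C$ such that $\mu-L:D(L)\to L^2(\mathbb R)$ has a bounded inverse. Let $\Gamma$ and $V(\lambda,\cdot)$, $\lambda\in\mathbb R$, be distributions on $\mathbb R$. We say that the *hypotheses of the existence theorem* for traveling waves, i.e. for solutions of $$-\Phi_{yy}-(1-V(\lambda,y))\Phi_{xx}+\Gamma(y)(\Phi^3)_{xx}=0,$$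 hold at $(k_*,\lambda_*)\in\mathbb N\times\mathbb R$ if $\Gamma=\gamma\delta_0$ and $V(\lambda,\cdot)=\lambda V_0+W+\alpha\delta_0$ for some $\gamma,\alpha\in\mathbb R$ and real-valued $V_0,W\in L^\infty(\mathbb R)$, and - $(\tilde L0)$ $V_0$ and $W$ are even; - $(\tilde L1)$ there is an interval $I\subset\mathbb R$ such that $0\in\rho(L_{0,\lambda}^k)$ for all $k\in\mathbb N$ and $\lambda\in I$; - $(\tilde L2)$ there is an open interval $I_{\lambda_*}\subset I$ containing $\lambda_*$ such that zero is an isolated point of the spectrum of $L_{\lambda_*}^{k_*}$ and an eigenvalue of it with one-dimensional eigenspace, and $0\in\rho(L_\lambda^k)$ for all $(k,\lambda)\in\mathbb N\times I_{\lambda_*}$ with $(k,\lambda)\ne(k_*,\lambda_*)$; - $(\tilde L3)$ there is $C>0$ such that for all $k\in\mathbb N$ and $\lambda\in I_{\lambda_*}$ the problem $-\phi''+k^2(1-\lambda V_0-W)\phi=0$ on $(0,\infty)$, $\phi(0)=1$, has a solution $\phi\in H^2(0,\infty)$, and every such solution satisfies $\|\phi\|_{L^2(0,\infty)}\le C$;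 - (transversality) $\int_{\mathbb R}V_0|\phi^*|^2\,dy\ne0$, where $\phi^*$ spans $\ker L_{\lambda_*}^{k_*}$. **Corollary 2.11** (Case P2, distributional $\Gamma$). Let $\gamma,\beta\in\mathbb R$, $k_*\in\mathbb N$ and $\lambda_*<1$, and let $\Gamma=\gamma\delta_0$ and $$V(\lambda,y)=\lambda\mathbf 1_{|y|\ge b}+\beta\mathbf 1_{|y|<b}+\alpha\delta_0(y),$$ where $b$ and $\alpha$ are as follows: - if $\beta>1$: $\displaystyle b=\frac{\pi}{\sqrt{\beta-1}}$ and $\displaystyle\alpha=\frac{2\sqrt{1-\lambda_*}}{k_*}$; - if $\beta<1$: $b>0$ is arbitrary and $$\alpha=\frac{2\sqrt{1-\beta}}{k_*}\cdot\frac{\sqrt{1-\beta}\,\sinh(k_*\sqrt{1-\beta}\,b)+\sqrt{1-\lambda_*}\,\cosh(k_*\sqrt{1-\beta}\,b)}{\sqrt{1-\beta}\,\cosh(k_*\sqrt{1-\beta}\,b)+\sqrt{1-\lambda_*}\,\sinh(k_*\sqrt{1-\beta}\,b)};$$ - if $\beta=1$: $b>0$ is arbitrary and $\displaystyle\alpha=\frac{2\sqrt{1-\lambda_*}}{k_*\bigl(1+\sqrt{1-\lambda_*}\,k_*b\bigr)}$.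 Then, in all three cases, $b>0$, $\alpha>0$, and the hypotheses of the existence theorem hold at $(k_*,\lambda_*)$. -/

import Mathlib

open MeasureTheory Filter Topology Set
open scoped ENNReal ContDiff Distributions

noncomputable section

namespace TravelingWave

/-! ### Weak derivatives and traces on the line -/

/-- `v` is the weak derivative of `u` on the open set `U ⊆ ℝ`:
`∫ u η' = - ∫ v η` for all test functions `η ∈ C_c^∞(U)`. It is only used for functions `u`, `v`
that are square integrable on `U`; their values outside `U` play no role. -/
def IsWeakDeriv (U : Set ℝ) (u v : ℝ → ℂ) : Prop :=
  ∀ η : ℝ → ℝ, ContDiff ℝ ∞ η → HasCompactSupport η → tsupport η ⊆ U →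
    ∫ y, deriv η y • u y = - ∫ y, η y • v y

/-- The (almost everywhere defined) function `u` has the limit `a` along the filter `l`, null sets
being disregarded. With `l = 𝓝[≠] 0` this says that `a` is the value at `0` of the representative
of `u` that is continuous there; with `l = 𝓝[>] 0` and `l = 𝓝[<] 0` it gives the one-sided
values `u(0+)` and `u(0-)`. -/
def HasTrace (l : Filter ℝ) (u : ℝ → ℂ) (a : ℂ) : Prop :=
  Tendsto u (l ⊓ ae volume) (𝓝 a)

/-- The complex Hilbert space `L²(ℝ)`. -/
abbrev L2 : Type := Lp ℂ 2 (volume : Measure ℝ)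

theorem integrable_smul_L2 (u : L2) {η : ℝ → ℝ} (hη : Continuous η) (hc : HasCompactSupport η) :
    Integrable (fun y => η y • u y) := by
  have h : LocallyIntegrable (u : ℝ → ℂ) := (Lp.memLp u).locallyIntegrable (by norm_num)
  exact h.integrable_smul_left_of_hasCompactSupport hη hc

theorem IsWeakDeriv.congr {U : Set ℝ} {u u₁ v v₁ : ℝ → ℂ} (h : IsWeakDeriv U u v)
    (hu : u =ᵐ[volume] u₁) (hv : v =ᵐ[volume] v₁) : IsWeakDeriv U u₁ v₁ := by
  intro η h1 h2 h3
  have e1 : ∫ y, deriv η y • u₁ y = ∫ y, deriv η y • u y :=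
    integral_congr_ae (by filter_upwards [hu] with y hy; rw [hy])
  have e2 : ∫ y, η y • v₁ y = ∫ y, η y • v y :=
    integral_congr_ae (by filter_upwards [hv] with y hy; rw [hy])
  rw [e1, e2]
  exact h η h1 h2 h3

theorem IsWeakDeriv.add {U : Set ℝ} {u u₁ v v₁ : L2} (h : IsWeakDeriv U u v)
    (h₁ : IsWeakDeriv U u₁ v₁) : IsWeakDeriv U (u + u₁ : L2) (v + v₁ : L2) := by
  have key : IsWeakDeriv U ((u : ℝ → ℂ) + u₁) ((v : ℝ → ℂ) + v₁) := by
    intro η d1 d2 d3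
    have c : Continuous η := d1.continuous
    have c' : Continuous (deriv η) := d1.continuous_deriv (by simp)
    simp only [Pi.add_apply, smul_add]
    rw [integral_add (integrable_smul_L2 u c' d2.deriv) (integrable_smul_L2 u₁ c' d2.deriv),
      integral_add (integrable_smul_L2 v c d2) (integrable_smul_L2 v₁ c d2),
      h η d1 d2 d3, h₁ η d1 d2 d3]
    ring
  exact key.congr (Lp.coeFn_add u u₁).symm (Lp.coeFn_add v v₁).symm

theorem IsWeakDeriv.smul {U : Set ℝ} {u v : L2} (c : ℂ) (h : IsWeakDeriv U u v) :
    IsWeakDeriv U (c • u : L2) (c • v : L2) := by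
  have key : IsWeakDeriv U (c • (u : ℝ → ℂ)) (c • (v : ℝ → ℂ)) := by
    intro η d1 d2 d3
    simp only [Pi.smul_apply, smul_comm _ c]
    rw [integral_smul, integral_smul, h η d1 d2 d3, smul_neg]
  exact key.congr (Lp.coeFn_smul c u).symm (Lp.coeFn_smul c v).symm

theorem IsWeakDeriv.zero (U : Set ℝ) : IsWeakDeriv U (0 : L2) (0 : L2) := by
  have key : IsWeakDeriv U (0 : ℝ → ℂ) (0 : ℝ → ℂ) := by intro η _ _ _; simp
  exact key.congr (Lp.coeFn_zero ℂ 2 volume).symm (Lp.coeFn_zero ℂ 2 volume).symm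

/-- Weak derivatives are unique (on `U`). -/
theorem IsWeakDeriv.ae_eq_zero {U : Set ℝ} (hU : IsOpen U) {u v : L2} (h : IsWeakDeriv U u v)
    (hu : ∀ᵐ y, y ∈ U → (u : ℝ → ℂ) y = 0) : ∀ᵐ y, y ∈ U → (v : ℝ → ℂ) y = 0 := by
  have hv : LocallyIntegrable (v : ℝ → ℂ) := (Lp.memLp v).locallyIntegrable (by norm_num)
  refine hU.ae_eq_zero_of_integral_contDiff_smul_eq_zero (hv.locallyIntegrableOn U) ?_
  intro g h1 h2 h3
  have e : ∫ y, deriv g y • u y = 0 := by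
    refine integral_eq_zero_of_ae ?_
    filter_upwards [hu] with y hy
    by_cases hyU : y ∈ U
    · simp [hy hyU]
    · have : deriv g y = 0 := by
        by_contra hne
        exact hyU (h3 (support_deriv_subset hne))
      simp [this]
  have := h g h1 h2 h3
  rw [e] at this
  simpa using this.symm

theorem HasTrace.congr {l : Filter ℝ} {u u₁ : ℝ → ℂ} {a : ℂ} (h : HasTrace l u a)
    (hu : u =ᵐ[volume] u₁) : HasTrace l u₁ a :=
  Tendsto.congr' (hu.filter_mono inf_le_right) h

theorem HasTrace.add {l : Filter ℝ} {u u₁ : L2} {a a₁ : ℂ} (h : HasTrace l u a)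
    (h₁ : HasTrace l u₁ a₁) : HasTrace l (u + u₁ : L2) (a + a₁) :=
  HasTrace.congr (u := (u : ℝ → ℂ) + u₁) (Tendsto.add h h₁) (Lp.coeFn_add u u₁).symm

theorem HasTrace.smul {l : Filter ℝ} {u : L2} {a : ℂ} (c : ℂ) (h : HasTrace l u a) :
    HasTrace l (c • u : L2) (c * a) :=
  HasTrace.congr (u := c • (u : ℝ → ℂ)) (Tendsto.const_smul h c) (Lp.coeFn_smul c u).symm

theorem HasTrace.zero (l : Filter ℝ) : HasTrace l (0 : L2) 0 :=
  HasTrace.congr (u := (0 : ℝ → ℂ)) tendsto_const_nhds (Lp.coeFn_zero ℂ 2 volume).symm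

/-! ### Schrödinger operators on `L²(ℝ)` -/

/-- The graph of `-d²/dy² + q` with domain `H²(ℝ)`: the pairs `(u, f)` with `u ∈ H²(ℝ)` and
`f = -u'' + q u ∈ L²(ℝ)`. For `q ∈ L^∞(ℝ)` the first components fill `H²(ℝ)`. -/
def regularGraph (q : ℝ → ℝ) : Submodule ℂ (L2 × L2) where
  carrier := {p | ∃ v w : L2, IsWeakDeriv univ p.1 v ∧ IsWeakDeriv univ v w ∧
    (p.2 : ℝ → ℂ) =ᵐ[volume] fun y => - w y + q y * p.1 y}
  zero_mem' := by
    refine ⟨0, 0, IsWeakDeriv.zero _, IsWeakDeriv.zero _, ?_⟩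
    filter_upwards [Lp.coeFn_zero ℂ 2 (volume : Measure ℝ)] with y hy
    simp
  add_mem' := by
    rintro ⟨u, f⟩ ⟨u₁, f₁⟩ ⟨v, w, h1, h2, h3⟩ ⟨v₁, w₁, k1, k2, k3⟩
    refine ⟨v + v₁, w + w₁, h1.add k1, h2.add k2, ?_⟩
    filter_upwards [Lp.coeFn_add f f₁, Lp.coeFn_add w w₁, Lp.coeFn_add u u₁, h3, k3]
      with y e1 e2 e3 e4 e5
    simp only [Prod.fst_add, Prod.snd_add, e1, e2, e3, Pi.add_apply] at *
    rw [e4, e5]; ring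
  smul_mem' := by
    rintro c ⟨u, f⟩ ⟨v, w, h1, h2, h3⟩
    refine ⟨c • v, c • w, h1.smul c, h2.smul c, ?_⟩
    filter_upwards [Lp.coeFn_smul c f, Lp.coeFn_smul c w, Lp.coeFn_smul c u, h3] with y e1 e2 e3 e4
    simp only [Prod.smul_fst, Prod.smul_snd, e1, e2, e3, Pi.smul_apply, smul_eq_mul] at *
    rw [e4]; ring

/-- The graph of `-d²/dy² + q - c δ₀` with domain
`{u ∈ H¹(ℝ) ∩ H²(ℝ ∖ {0}) | u'(0+) - u'(0-) = -c u(0)}`: the pairs `(u, f)` with `u` in this domain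
and `f = -u'' + q u ∈ L²(ℝ)`, the second derivative being taken on `ℝ ∖ {0}`. -/
def deltaGraph (q : ℝ → ℝ) (c : ℝ) : Submodule ℂ (L2 × L2) where
  carrier := {p | ∃ v w : L2, ∃ a r l : ℂ, IsWeakDeriv univ p.1 v ∧ IsWeakDeriv {0}ᶜ v w ∧
    HasTrace (𝓝[≠] 0) p.1 a ∧ HasTrace (𝓝[>] 0) v r ∧ HasTrace (𝓝[<] 0) v l ∧
    r - l = - c * a ∧
    (p.2 : ℝ → ℂ) =ᵐ[volume] fun y => - w y + q y * p.1 y}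
  zero_mem' := by
    refine ⟨0, 0, 0, 0, 0, IsWeakDeriv.zero _, IsWeakDeriv.zero _, HasTrace.zero _,
      HasTrace.zero _, HasTrace.zero _, by simp, ?_⟩
    filter_upwards [Lp.coeFn_zero ℂ 2 (volume : Measure ℝ)] with y hy
    simp
  add_mem' := by
    rintro ⟨u, f⟩ ⟨u₁, f₁⟩ ⟨v, w, a, r, l, h1, h2, t1, t2, t3, j, h3⟩
      ⟨v₁, w₁, a₁, r₁, l₁, k1, k2, s1, s2, s3, j₁, k3⟩
    refine ⟨v + v₁, w + w₁, a + a₁, r + r₁, l + l₁, h1.add k1, h2.add k2, t1.add s1, t2.add s2,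
      t3.add s3, by linear_combination j + j₁, ?_⟩
    filter_upwards [Lp.coeFn_add f f₁, Lp.coeFn_add w w₁, Lp.coeFn_add u u₁, h3, k3]
      with y e1 e2 e3 e4 e5
    simp only [Prod.fst_add, Prod.snd_add, e1, e2, e3, Pi.add_apply] at *
    rw [e4, e5]; ring
  smul_mem' := by
    rintro z ⟨u, f⟩ ⟨v, w, a, r, l, h1, h2, t1, t2, t3, j, h3⟩
    refine ⟨z • v, z • w, z * a, z * r, z * l, h1.smul z, h2.smul z, t1.smul z, t2.smul z,
      t3.smul z, by linear_combination z * j, ?_⟩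
    filter_upwards [Lp.coeFn_smul z f, Lp.coeFn_smul z w, Lp.coeFn_smul z u, h3] with y e1 e2 e3 e4
    simp only [Prod.smul_fst, Prod.smul_snd, e1, e2, e3, Pi.smul_apply, smul_eq_mul] at *
    rw [e4]; ring

theorem regularGraph_single_valued (q : ℝ → ℝ) (p : L2 × L2) (hp : p ∈ regularGraph q)
    (h0 : p.1 = 0) : p.2 = 0 := by
  obtain ⟨u, f⟩ := p
  obtain ⟨v, w, h1, h2, h3⟩ := hp
  simp only at h0
  subst h0
  have z := Lp.coeFn_zero ℂ 2 (volume : Measure ℝ)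
  have hv := h1.ae_eq_zero isOpen_univ (by filter_upwards [z] with y hy _; simp)
  have hw := h2.ae_eq_zero isOpen_univ hv
  apply Lp.ext
  filter_upwards [z, hw, h3] with y e1 e2 e3
  simp_all

theorem deltaGraph_single_valued (q : ℝ → ℝ) (c : ℝ) (p : L2 × L2) (hp : p ∈ deltaGraph q c)
    (h0 : p.1 = 0) : p.2 = 0 := by
  obtain ⟨u, f⟩ := p
  obtain ⟨v, w, a, r, l, h1, h2, -, -, -, -, h3⟩ := hp
  simp only at h0
  subst h0
  have z := Lp.coeFn_zero ℂ 2 (volume : Measure ℝ)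
  have hv := h1.ae_eq_zero isOpen_univ (by filter_upwards [z] with y hy _; simp)
  have hw := h2.ae_eq_zero isOpen_compl_singleton (hv.mono fun y hy _ => hy (mem_univ y))
  apply Lp.ext
  filter_upwards [z, hw, h3, compl_mem_ae_iff.mpr (measure_singleton (μ := volume) (0 : ℝ))]
    with y e1 e2 e3 e4
  have e5 := e2 e4
  simp_all

/-- The operator `-d²/dy² + q : H²(ℝ) ⊆ L²(ℝ) → L²(ℝ)`. Its graph is `regularGraph q`. -/
def regularOp (q : ℝ → ℝ) : L2 →ₗ.[ℂ] L2 := (regularGraph q).toLinearPMap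

/-- The operator `-d²/dy² + q - c δ₀` in `L²(ℝ)`. Its graph is `deltaGraph q c`. -/
def deltaOp (q : ℝ → ℝ) (c : ℝ) : L2 →ₗ.[ℂ] L2 := (deltaGraph q c).toLinearPMap

theorem regularOp_graph (q : ℝ → ℝ) : (regularOp q).graph = regularGraph q :=
  Submodule.toLinearPMap_graph_eq _ (regularGraph_single_valued q)

theorem deltaOp_graph (q : ℝ → ℝ) (c : ℝ) : (deltaOp q c).graph = deltaGraph q c :=
  Submodule.toLinearPMap_graph_eq _ (deltaGraph_single_valued q c)

/-- The resolvent set of an unbounded operator `L`: the `μ ∈ ℂ` for which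
`μ - L : D(L) → L²(ℝ)` is bijective with bounded inverse. -/
def resolvent (L : L2 →ₗ.[ℂ] L2) : Set ℂ :=
  {μ | Function.Bijective (fun u : L.domain => μ • (u : L2) - L u) ∧
    ∃ C : ℝ, ∀ u : L.domain, ‖(u : L2)‖ ≤ C * ‖μ • (u : L2) - L u‖}

/-- The kernel `{u ∈ D(L) | L u = 0}`. -/
def kernel (L : L2 →ₗ.[ℂ] L2) : Submodule ℂ L2 :=
  (LinearMap.ker L.toFun).map L.domain.subtype

/-- Zero is an isolated point of the spectrum and an eigenvalue with one-dimensional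
eigenspace. -/
def ZeroIsIsolatedSimpleEigenvalue (L : L2 →ₗ.[ℂ] L2) : Prop :=
  Module.finrank ℂ (kernel L) = 1 ∧
    ∃ ε : ℝ, 0 < ε ∧ ∀ μ : ℂ, 0 < ‖μ‖ → ‖μ‖ < ε → μ ∈ resolvent L

/-! ### The wave operators and the hypotheses of the existence theorem -/

/-- The coefficient `k² (1 - λ V₀(y) - W(y))`. -/
def waveCoeff (V₀ W : ℝ → ℝ) (k : ℕ) (lam : ℝ) (y : ℝ) : ℝ :=
  (k : ℝ) ^ 2 * (1 - lam * V₀ y - W y)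

/-- `L_{0,λ}^k = -d²/dy² + k² (1 - λ V₀ - W)` on `H²(ℝ)`. -/
def regularWaveOp (V₀ W : ℝ → ℝ) (k : ℕ) (lam : ℝ) : L2 →ₗ.[ℂ] L2 :=
  regularOp (waveCoeff V₀ W k lam)

/-- `L_λ^k = -d²/dy² + k² (1 - λ V₀ - W - α δ₀)`. -/
def waveOp (V₀ W : ℝ → ℝ) (α : ℝ) (k : ℕ) (lam : ℝ) : L2 →ₗ.[ℂ] L2 :=
  deltaOp (waveCoeff V₀ W k lam) ((k : ℝ) ^ 2 * α)

/-- `φ ∈ H²(0,∞)`, `-φ'' + q φ = 0` on `(0,∞)` and `φ(0) = 1`. -/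
def IsDecayingMode (q : ℝ → ℝ) (φ : ℝ → ℂ) : Prop :=
  MemLp φ 2 (volume.restrict (Ioi 0)) ∧
  (∃ v w : ℝ → ℂ, MemLp v 2 (volume.restrict (Ioi 0)) ∧ MemLp w 2 (volume.restrict (Ioi 0)) ∧
    IsWeakDeriv (Ioi 0) φ v ∧ IsWeakDeriv (Ioi 0) v w ∧
    ∀ᵐ y, y ∈ Ioi (0 : ℝ) → - w y + q y * φ y = 0) ∧
  HasTrace (𝓝[>] 0) φ 1

/-- Real distributions on the line. -/
abbrev LineDistribution : Type := 𝓓'((⊤ : TopologicalSpace.Opens ℝ), ℝ)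

/-- The distribution `η ↦ ∫ f η` of a locally integrable function `f`. -/
def regularDistribution (f : ℝ → ℝ) : LineDistribution :=
  TestFunction.integralAgainstBilinCLM (ContinuousLinearMap.mul ℝ ℝ) volume f

/-- The Dirac distribution at the origin. -/
def delta0 : LineDistribution := Distribution.delta (0 : ℝ)

/-- The hypotheses of the existence theorem for traveling waves with distributional `Γ`, at the
wavenumber `kstar` and the parameter value `lamstar`, for
`-Φ_yy - (1 - V(λ,y)) Φ_xx + Γ(y) (Φ³)_xx = 0`. The functions `V₀`, `W` (up to null sets) and the
numbers `α`, `γ` are determined by `V` and `Γ`. -/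
def ExistenceHypotheses (Γ : LineDistribution) (V : ℝ → LineDistribution) (kstar : ℕ)
    (lamstar : ℝ) : Prop :=
  ∃ (γ α : ℝ) (V₀ W : ℝ → ℝ),
    -- the form of the coefficients
    Γ = γ • delta0 ∧
    (∀ lam : ℝ, V lam = lam • regularDistribution V₀ + regularDistribution W + α • delta0) ∧
    -- `V₀` and `W` are bounded and even
    (MemLp V₀ ∞ volume ∧ MemLp W ∞ volume ∧ V₀.Even ∧ W.Even) ∧
    ∃ I J : Set ℝ,
      -- `0` lies in the resolvent set of the regular operators for `λ` in an interval `I`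
      (I.OrdConnected ∧
        ∀ k : ℕ, 1 ≤ k → ∀ lam ∈ I, (0 : ℂ) ∈ resolvent (regularWaveOp V₀ W k lam)) ∧
      -- on an open interval `J ⊆ I` around `lamstar`, zero is in the spectrum of the full operator
      -- only at `(kstar, lamstar)`, where it is an isolated simple eigenvalue
      (IsOpen J ∧ J.OrdConnected ∧ J ⊆ I ∧ lamstar ∈ J ∧
        ZeroIsIsolatedSimpleEigenvalue (waveOp V₀ W α kstar lamstar) ∧
        ∀ k : ℕ, 1 ≤ k → ∀ lam ∈ J, (k, lam) ≠ (kstar, lamstar) →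
          (0 : ℂ) ∈ resolvent (waveOp V₀ W α k lam)) ∧
      -- the decaying modes exist and are uniformly bounded in `L²(0,∞)`
      (∃ C : ℝ, 0 < C ∧ ∀ k : ℕ, 1 ≤ k → ∀ lam ∈ J,
        (∃ φ, IsDecayingMode (waveCoeff V₀ W k lam) φ) ∧
        ∀ φ, IsDecayingMode (waveCoeff V₀ W k lam) φ →
          eLpNorm φ 2 (volume.restrict (Ioi 0)) ≤ ENNReal.ofReal C) ∧
      -- transversality, for any `φ` that spans the kernel
      (∀ φ : L2, kernel (waveOp V₀ W α kstar lamstar) = Submodule.span ℂ {φ} →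
        ∫ y, V₀ y * ‖φ y‖ ^ 2 ≠ 0)

/-- The potential `V(λ,y) = λ 1_{|y| ≥ b} + β 1_{|y| < b} + α δ₀(y)`. -/
def stepPotential (β b α : ℝ) (lam : ℝ) : LineDistribution :=
  lam • regularDistribution ({y : ℝ | b ≤ |y|}.indicator 1) +
    β • regularDistribution ({y : ℝ | |y| < b}.indicator 1) + α • delta0

end TravelingWave

end

/-! Since all coefficients are even, everything reduces to the half line. There -φ'' + qφ = 0, with
q = k²(1-β) on (0,b) and q = k²(1-λ) beyond b, has up to scaling one square integrable solution ψ.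
Normalised by ψ(0) = 1 it has slope ψ'(0) = -k² P_k(t), where t = √(1-λ) and P_k is explicit in each
of the three cases.

A solution of -u'' + qu = f is, on each half line, the Dirichlet solution plus u(0)ψ. Only the jump
condition at the origin remains, so the operator with interaction -cδ₀ is encoded in one scalar
equation for s = u(0), namely (2ψ'(0) + c) s = -⟨ψ(|·|), f⟩ (`HalfLineBasis.isGluedSolution_iff`).
If 2ψ'(0) + c ≠ 0, the inverse is a rank one perturbation of the Dirichlet solution operator, which
is bounded by the Schur test; the regular operator is the case c = 0, where P_k > 0 suffices. If
2ψ'(0) + c = 0, the kernel is spanned by ψ(|·|), and a perturbation argument shows that zero is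
isolated (`zeroIsIsolatedSimpleEigenvalue_of_graph`).

With c = k²α the critical condition is the dispersion relation α = 2 P_k(t), and the prescribed α
solves it at (k_*, λ_*). Because P_k(t) is strictly decreasing in k and P_{k_*} is injective in t,
there is no other solution near λ_*, uniformly in k (`eventually_dispersion_eq_imp`). Transversality
holds because V₀ is the indicator of |y| ≥ b, where ψ is a nonzero multiple of an exponential. The
uniform L² bound comes from a bound for ψ on [0,b] and the decay rate kt ≥ t_*/2 beyond b, where t_*
= √(1-λ_*).

`existenceHypotheses_of_dispersion` carries this out for abstract P; the three cases verify its
assumptions. -/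

noncomputable section

namespace TravelingWave

/-! ### Primitives on intervals -/

/-- On the set `s` the function `u` is a primitive of the locally integrable function `v`. -/
def IsPrimitiveOn (u v : ℝ → ℂ) (s : Set ℝ) : Prop :=
  ∀ a ∈ s, ∀ b ∈ s, IntervalIntegrable v volume a b ∧ ∫ t in a..b, v t = u b - u a

/-- Increments of the integral of `v` are dominated by those of the integral of ‖v‖, which reduces
the claim to a real integrand. -/
theorem absolutelyContinuousOnInterval_integral {v : ℝ → ℂ} {a b : ℝ}
    (h : IntervalIntegrable v volume a b) :
    AbsolutelyContinuousOnInterval (fun x => ∫ t in a..x, v t) a b := by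
  have hN := h.norm.absolutelyContinuousOnInterval_intervalIntegral (c := a) left_mem_uIcc
  unfold AbsolutelyContinuousOnInterval at hN ⊢
  refine squeeze_zero' (Eventually.of_forall fun _ => Finset.sum_nonneg fun i _ => dist_nonneg)
    ?_ hN
  rw [eventually_inf_principal]
  filter_upwards with E hE
  refine Finset.sum_le_sum fun i hi => ?_
  obtain ⟨hx, hy⟩ := hE.1 i hi
  have ix : IntervalIntegrable v volume a (E.2 i).1 :=
    h.mono_set (uIcc_subset_uIcc left_mem_uIcc hx)
  have iy : IntervalIntegrable v volume a (E.2 i).2 :=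
    h.mono_set (uIcc_subset_uIcc left_mem_uIcc hy)
  rw [dist_eq_norm, dist_eq_norm, intervalIntegral.integral_interval_sub_left ix iy,
    intervalIntegral.integral_interval_sub_left ix.norm iy.norm, Real.norm_eq_abs]
  exact intervalIntegral.norm_integral_le_abs_integral_norm

theorem IsPrimitiveOn.eq_add_integral {u v : ℝ → ℂ} {s : Set ℝ} (h : IsPrimitiveOn u v s) {a x : ℝ}
    (ha : a ∈ s) (hx : x ∈ s) : u x = u a + ∫ t in a..x, v t := by
  rw [(h a ha x hx).2]; ring

theorem IsPrimitiveOn.continuousOn_uIcc {u v : ℝ → ℂ} {s : Set ℝ} (hs : s.OrdConnected)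
    (h : IsPrimitiveOn u v s) {a b : ℝ} (ha : a ∈ s) (hb : b ∈ s) : ContinuousOn u (uIcc a b) := by
  have hac := absolutelyContinuousOnInterval_integral (h a ha b hb).1
  refine ((continuousOn_const (c := u a)).add hac.continuousOn).congr fun x hx => ?_
  exact h.eq_add_integral ha (hs.uIcc_subset ha hb hx)

theorem IsPrimitiveOn.add {u v u₁ v₁ : ℝ → ℂ} {s : Set ℝ} (h : IsPrimitiveOn u v s)
    (h₁ : IsPrimitiveOn u₁ v₁ s) :
    IsPrimitiveOn (fun y => u y + u₁ y) (fun y => v y + v₁ y) s := by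
  intro a ha b hb
  obtain ⟨i, e⟩ := h a ha b hb
  obtain ⟨i₁, e₁⟩ := h₁ a ha b hb
  refine ⟨i.add i₁, ?_⟩
  rw [intervalIntegral.integral_add i i₁, e, e₁]; ring

theorem IsPrimitiveOn.const_mul {u v : ℝ → ℂ} {s : Set ℝ} (c : ℂ) (h : IsPrimitiveOn u v s) :
    IsPrimitiveOn (fun y => c * u y) (fun y => c * v y) s := by
  intro a ha b hb
  obtain ⟨i, e⟩ := h a ha b hb
  refine ⟨i.const_mul c, ?_⟩
  rw [intervalIntegral.integral_const_mul, e]; ring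

theorem IsPrimitiveOn.sub {u v u₁ v₁ : ℝ → ℂ} {s : Set ℝ} (h : IsPrimitiveOn u v s)
    (h₁ : IsPrimitiveOn u₁ v₁ s) :
    IsPrimitiveOn (fun y => u y - u₁ y) (fun y => v y - v₁ y) s := by
  simpa [sub_eq_add_neg] using h.add (h₁.const_mul (-1))

theorem IsPrimitiveOn.congr_deriv {u v v₁ : ℝ → ℂ} {s : Set ℝ} (hs : s.OrdConnected)
    (h : IsPrimitiveOn u v s) (e : ∀ᵐ y, y ∈ s → v y = v₁ y) : IsPrimitiveOn u v₁ s := by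
  intro a ha b hb
  obtain ⟨i, e₁⟩ := h a ha b hb
  have e₂ : ∀ᵐ y, y ∈ uIoc a b → v y = v₁ y := by
    filter_upwards [e] with y hy hy'
    exact hy (hs.uIcc_subset ha hb (uIoc_subset_uIcc hy'))
  refine ⟨i.congr_ae ((ae_restrict_iff' measurableSet_uIoc).2 e₂), ?_⟩
  rw [← e₁]
  exact intervalIntegral.integral_congr_ae (e₂.mono fun y hy h => (hy h).symm)

theorem IsPrimitiveOn.congr {u u₁ v : ℝ → ℂ} {s : Set ℝ}
    (h : IsPrimitiveOn u v s) (e : ∀ y ∈ s, u y = u₁ y) : IsPrimitiveOn u₁ v s := by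
  intro a ha b hb
  rw [← e a ha, ← e b hb]
  exact h a ha b hb

/-- The countable exceptional set `t` accommodates the point `b` where a step coefficient jumps and
the pieces are glued. -/
theorem isPrimitiveOn_of_hasDerivAt {u v : ℝ → ℂ} {s t : Set ℝ} (hs : s.OrdConnected)
    (ht : t.Countable) (hu : Continuous u) (hd : ∀ y ∈ interior s, y ∉ t → HasDerivAt u (v y) y)
    (hv : ∀ a ∈ s, ∀ b ∈ s, IntervalIntegrable v volume a b) : IsPrimitiveOn u v s := by
  intro a ha b hb
  refine ⟨hv a ha b hb, ?_⟩
  refine MeasureTheory.integral_eq_of_hasDerivAt_off_countable u v ht hu.continuousOn ?_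
    (hv a ha b hb)
  intro x hx
  refine hd x ?_ hx.2
  exact interior_mono (hs.uIcc_subset ha hb) (isOpen_Ioo.subset_interior_iff.2
    Ioo_subset_Icc_self hx.1)

/-- The product rule for absolutely continuous functions. It yields every Wronskian identity and
integration by parts below. -/
theorem IsPrimitiveOn.mul {u v u₁ v₁ : ℝ → ℂ} {s : Set ℝ} (hs : s.OrdConnected)
    (h : IsPrimitiveOn u v s) (h₁ : IsPrimitiveOn u₁ v₁ s) :
    IsPrimitiveOn (fun y => u y * u₁ y) (fun y => v y * u₁ y + u y * v₁ y) s := by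
  intro a ha b hb
  have hsub := hs.uIcc_subset ha hb
  obtain ⟨i, e⟩ := h a ha b hb
  obtain ⟨i₁, e₁⟩ := h₁ a ha b hb
  have iw : IntervalIntegrable (fun y => v y * u₁ y + u y * v₁ y) volume a b :=
    (i.mul_continuousOn (h₁.continuousOn_uIcc hs ha hb)).add
      (i₁.continuousOn_mul (h.continuousOn_uIcc hs ha hb))
  refine ⟨iw, ?_⟩
  have cst (c : ℂ) : AbsolutelyContinuousOnInterval (fun _ : ℝ => c) a b :=
    contDiffOn_const.absolutelyContinuousOnInterval
  have hU := (cst (u a)).fun_add (absolutelyContinuousOnInterval_integral i)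
  have hU₁ := (cst (u₁ a)).fun_add (absolutelyContinuousOnInterval_integral i₁)
  have hg := (hU.fun_smul hU₁).fun_sub (absolutelyContinuousOnInterval_integral iw)
  -- The product minus the primitive of its expected derivative is absolutely continuous with
  -- derivative zero almost everywhere, hence constant.
  obtain ⟨C, hC⟩ := hg.const_of_ae_hasDerivAt_zero (by
    filter_upwards [i.ae_hasDerivAt_integral, i₁.ae_hasDerivAt_integral,
      iw.ae_hasDerivAt_integral] with x d d₁ dw hx
    have k := (((d hx a left_mem_uIcc).const_add (u a)).mul
      ((d₁ hx a left_mem_uIcc).const_add (u₁ a))).sub (dw hx a left_mem_uIcc)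
    refine k.congr_deriv ?_
    rw [← h.eq_add_integral ha (hsub hx), ← h₁.eq_add_integral ha (hsub hx)]
    ring)
  have ca := hC a left_mem_uIcc
  have cb := hC b right_mem_uIcc
  simp only [intervalIntegral.integral_same, add_zero, sub_zero, smul_eq_mul] at ca cb
  rw [← h.eq_add_integral ha hb, ← h₁.eq_add_integral ha hb] at cb
  linear_combination ca - cb

theorem IsPrimitiveOn.continuousOn_Ici {u v : ℝ → ℂ} (h : IsPrimitiveOn u v (Ici 0)) :
    ContinuousOn u (Ici 0) := by
  intro x hx
  have hx0 : (0 : ℝ) ≤ x := hx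
  have hc := h.continuousOn_uIcc ordConnected_Ici (a := 0) (b := x + 1) self_mem_Ici
    (by simp only [mem_Ici]; linarith)
  rw [uIcc_of_le (by linarith)] at hc
  refine (hc x ⟨hx0, by linarith⟩).mono_of_mem_nhdsWithin ?_
  rw [mem_nhdsWithin]
  exact ⟨Iio (x + 1), isOpen_Iio, by simp, fun y hy => ⟨hy.2, le_of_lt hy.1⟩⟩

theorem isPrimitiveOn_ofReal_of_contDiff {η : ℝ → ℝ} (hη : ContDiff ℝ ∞ η) {s : Set ℝ}
    (hs : s.OrdConnected) :
    IsPrimitiveOn (fun y => (η y : ℂ)) (fun y => ((deriv η y : ℝ) : ℂ)) s := by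
  have c' : Continuous (deriv η) := hη.continuous_deriv (by simp)
  refine isPrimitiveOn_of_hasDerivAt hs countable_empty
    (Complex.continuous_ofReal.comp hη.continuous) (fun y _ _ => ?_) ?_
  · exact ((hη.differentiable (by simp)) y).hasDerivAt.ofReal_comp
  · intro a _ b _
    exact (Complex.continuous_ofReal.comp c').intervalIntegrable a b

theorem exists_forall_le_eq_zero_of_hasCompactSupport {η : ℝ → ℝ} (hc : HasCompactSupport η) :
    ∃ B, 0 < B ∧ ∀ y, B ≤ y → η y = 0 ∧ deriv η y = 0 := by
  obtain ⟨r, hr⟩ := hc.isCompact.bddAbove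
  refine ⟨max 1 (r + 1), by positivity, fun y hy => ?_⟩
  have hy' : y ∉ tsupport η := fun hmem => by
    have := hr hmem
    have := le_max_right 1 (r + 1)
    linarith
  exact ⟨image_eq_zero_of_notMem_tsupport hy', by
    by_contra hne; exact hy' (support_deriv_subset hne)⟩

/-- Integration by parts on the half line against a test function. -/
theorem IsPrimitiveOn.integral_deriv_smul {u v : ℝ → ℂ} (h : IsPrimitiveOn u v (Ici 0))
    {η : ℝ → ℝ} (hη : ContDiff ℝ ∞ η) (hc : HasCompactSupport η) :
    ∫ y in Ioi 0, deriv η y • u y = - (η 0 • u 0) - ∫ y in Ioi 0, η y • v y := by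
  obtain ⟨B, hB, hz⟩ := exists_forall_le_eq_zero_of_hasCompactSupport hc
  have hBm : B ∈ Ici (0 : ℝ) := hB.le
  have cut (g : ℝ → ℂ) (hg : ∀ y, B ≤ y → g y = 0) :
      ∫ y in Ioi 0, g y = ∫ y in (0 : ℝ)..B, g y := by
    rw [intervalIntegral.integral_of_le hB.le]
    refine setIntegral_eq_of_subset_of_forall_sdiff_eq_zero measurableSet_Ioi
      (fun y hy => hy.1) fun y hy => hg y ?_
    by_contra hlt
    exact hy.2 ⟨hy.1, (not_le.1 hlt).le⟩
  have hp := (isPrimitiveOn_ofReal_of_contDiff hη ordConnected_Ici).mul ordConnected_Ici h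
  obtain ⟨-, e⟩ := hp 0 self_mem_Ici B hBm
  have iv := (h 0 self_mem_Ici B hBm).1
  have c' : Continuous (deriv η) := hη.continuous_deriv (by simp)
  have hu := h.continuousOn_uIcc ordConnected_Ici self_mem_Ici hBm
  have i₁ : IntervalIntegrable (fun y => ((deriv η y : ℝ) : ℂ) * u y) volume 0 B :=
    ((Complex.continuous_ofReal.comp c').continuousOn.mul hu).intervalIntegrable
  have i₂ : IntervalIntegrable (fun y => (η y : ℂ) * v y) volume 0 B :=
    iv.continuousOn_mul (Complex.continuous_ofReal.comp hη.continuous).continuousOn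
  simp only at e
  rw [intervalIntegral.integral_add i₁ i₂] at e
  rw [cut _ fun y hy => by rw [(hz y hy).2, zero_smul],
    cut _ fun y hy => by rw [(hz y hy).1, zero_smul]]
  simp only [Complex.real_smul]
  rw [(hz B le_rfl).1] at e
  simp only [Complex.ofReal_zero, zero_mul, zero_sub] at e
  linear_combination e

/-! ### Weak derivatives on the half line -/

/-- The primitive based at 0 vanishes left of the support of `ζ`, and right of it because the mean
of `ζ` is zero; so it is again a test function. -/
theorem exists_test_primitive {ζ : ℝ → ℝ} (hζ : ContDiff ℝ ∞ ζ) (hc : HasCompactSupport ζ)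
    (hs : tsupport ζ ⊆ Ioi 0) (hint : ∫ y, ζ y = 0) :
    ∃ η : ℝ → ℝ, ContDiff ℝ ∞ η ∧ HasCompactSupport η ∧ tsupport η ⊆ Ioi 0 ∧ deriv η = ζ := by
  obtain ⟨a, ha, haz⟩ : ∃ a : ℝ, 0 < a ∧ ∀ y, y ≤ a → ζ y = 0 := by
    rcases (tsupport ζ).eq_empty_or_nonempty with h0 | h0
    · exact ⟨1, one_pos, fun y _ => image_eq_zero_of_notMem_tsupport (by simp [h0])⟩
    · obtain ⟨m, hm, hmin⟩ := hc.isCompact.exists_isLeast h0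
      refine ⟨m / 2, half_pos (hs hm), fun y hy => image_eq_zero_of_notMem_tsupport fun hmem => ?_⟩
      have h1 := hmin hmem
      have h2 : (0 : ℝ) < m := hs hm
      linarith
  obtain ⟨B, hB, hBz⟩ := exists_forall_le_eq_zero_of_hasCompactSupport hc
  have cζ := hζ.continuous
  have hd (y : ℝ) : HasDerivAt (fun x => ∫ t in (0 : ℝ)..x, ζ t) (ζ y) y :=
    cζ.integral_hasStrictDerivAt 0 y |>.hasDerivAt
  have hdd : deriv (fun x => ∫ t in (0 : ℝ)..x, ζ t) = ζ := funext fun y => (hd y).deriv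
  have z1 : ∀ y, y ≤ a → ∫ t in (0 : ℝ)..y, ζ t = 0 := fun y hy => by
    refine intervalIntegral.integral_zero_ae (Eventually.of_forall fun t ht => haz t ?_)
    rcases ht with ⟨_, h2⟩
    exact h2.trans (max_le ha.le hy)
  have z2 : ∀ y, B ≤ y → ∫ t in (0 : ℝ)..y, ζ t = 0 := fun y hy => by
    refine Eq.trans ?_ hint
    rw [intervalIntegral.integral_of_le (hB.le.trans hy)]
    refine setIntegral_eq_integral_of_forall_compl_eq_zero fun t ht => ?_
    by_cases h0 : 0 < t
    · refine (hBz t ?_).1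
      by_contra hlt
      exact ht ⟨h0, by linarith⟩
    · exact haz t (by linarith)
  have hsup : tsupport (fun x => ∫ t in (0 : ℝ)..x, ζ t) ⊆ Icc a B := by
    refine closure_minimal (fun y hy => ?_) isClosed_Icc
    by_contra hn
    rw [mem_Icc, not_and_or, not_le, not_le] at hn
    rcases hn with hn | hn
    · exact hy (z1 y hn.le)
    · exact hy (z2 y hn.le)
  refine ⟨_, ?_, ?_, hsup.trans fun y hy => ha.trans_le hy.1, hdd⟩
  · rw [contDiff_infty_iff_deriv]
    exact ⟨fun y => (hd y).differentiableAt, by rwa [hdd]⟩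
  · exact HasCompactSupport.of_support_subset_isCompact isCompact_Icc
      (subset_closure.trans hsup)

theorem _root_.MeasureTheory.LocallyIntegrable.intervalIntegrable {v : ℝ → ℂ}
    (hv : LocallyIntegrable v) (a b : ℝ) : IntervalIntegrable v volume a b :=
  (hv.integrableOn_isCompact isCompact_uIcc).intervalIntegrable

theorem isPrimitiveOn_integral {v : ℝ → ℂ} (i : ∀ a b, IntervalIntegrable v volume a b)
    (s : Set ℝ) : IsPrimitiveOn (fun y => ∫ t in (0 : ℝ)..y, v t) v s := by
  intro a _ b _
  exact ⟨i a b, (intervalIntegral.integral_interval_sub_left (i 0 b) (i 0 a)).symm⟩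

theorem integral_eq_setIntegral_Ioi_of_tsupport {η : ℝ → ℝ} (hs : tsupport η ⊆ Ioi 0)
    (u : ℝ → ℂ) : ∫ y, η y • u y = ∫ y in Ioi 0, η y • u y := by
  refine (setIntegral_eq_integral_of_forall_compl_eq_zero fun y hy => ?_).symm
  rw [image_eq_zero_of_notMem_tsupport fun h => hy (hs h), zero_smul]

/-- The lemma of du Bois-Reymond on the half line. -/
theorem IsWeakDeriv.ae_eq_const_add_integral {u v : ℝ → ℂ} (hu : LocallyIntegrable u)
    (hv : LocallyIntegrable v) (h : IsWeakDeriv (Ioi 0) u v) :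
    ∃ c : ℂ, ∀ᵐ y, y ∈ Ioi (0 : ℝ) → u y = c + ∫ t in (0 : ℝ)..y, v t := by
  set U : ℝ → ℂ := fun y => ∫ t in (0 : ℝ)..y, v t with hU
  have hUc : Continuous U := intervalIntegral.continuous_primitive
    hv.intervalIntegrable 0
  have hz : LocallyIntegrable (fun y => u y - U y) := hu.sub hUc.locallyIntegrable
  -- The difference `u - U` has weak derivative zero on the half line; what follows shows that it is
  -- constant.
  have key : ∀ η : ℝ → ℝ, ContDiff ℝ ∞ η → HasCompactSupport η → tsupport η ⊆ Ioi 0 →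
      ∫ y, deriv η y • (u y - U y) = 0 := by
    intro η h1 h2 h3
    have c' : Continuous (deriv η) := h1.continuous_deriv (by simp)
    have e1 := h η h1 h2 h3
    have h0 : η 0 = 0 := image_eq_zero_of_notMem_tsupport fun hm => lt_irrefl (0 : ℝ) (h3 hm)
    have e2 : ∫ y, deriv η y • U y = - ∫ y, η y • v y := by
      rw [integral_eq_setIntegral_Ioi_of_tsupport (tsupport_deriv_subset.trans h3),
        integral_eq_setIntegral_Ioi_of_tsupport h3,
        (isPrimitiveOn_integral hv.intervalIntegrable (Ici 0)).integral_deriv_smul h1 h2, h0]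
      simp
    simp only [smul_sub]
    rw [integral_sub (hu.integrable_smul_left_of_hasCompactSupport c' h2.deriv)
      (hUc.locallyIntegrable.integrable_smul_left_of_hasCompactSupport c' h2.deriv), e1, e2,
      sub_self]
  -- Centre 2 and outer radius 1 keep the support in [1,3]. The constant will be the average of `u -
  -- U` against this unit mass.
  let bump : ContDiffBump (2 : ℝ) := ⟨1 / 2, 1, by norm_num, by norm_num⟩
  set ρ : ℝ → ℝ := bump.normed volume with hρ
  have ρ1 : ContDiff ℝ ∞ ρ := bump.contDiff_normed
  have ρ2 : HasCompactSupport ρ := bump.hasCompactSupport_normed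
  have ρ3 : tsupport ρ ⊆ Ioi 0 := by
    rw [hρ, bump.tsupport_normed_eq]
    intro y hy
    rw [Metric.mem_closedBall, Real.dist_eq] at hy
    have := (abs_le.1 hy).1
    have h1 : bump.rOut = 1 := rfl
    rw [h1] at this
    simp only [mem_Ioi]; linarith
  have ρ4 : ∫ y, ρ y = 1 := bump.integral_normed
  set c : ℂ := ∫ y, ρ y • (u y - U y) with hcdef
  refine ⟨c, ?_⟩
  have hz' : LocallyIntegrable (fun y => u y - U y - c) := hz.sub continuous_const.locallyIntegrable
  have hfin : ∀ᵐ y, y ∈ Ioi (0 : ℝ) → u y - U y - c = 0 := by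
    refine isOpen_Ioi.ae_eq_zero_of_integral_contDiff_smul_eq_zero (hz'.locallyIntegrableOn _) ?_
    intro ζ h1 h2 h3
    have iζ : Integrable ζ := h1.continuous.integrable_of_hasCompactSupport h2
    have iρ : Integrable ρ := ρ1.continuous.integrable_of_hasCompactSupport ρ2
    set J : ℝ := ∫ y, ζ y with hJ
    -- Subtracting `J * ρ` removes the mean of `ζ`, so the remainder is the derivative of a test
    -- function and `key` applies.
    obtain ⟨η, k1, k2, k3, k4⟩ := exists_test_primitive (ζ := fun y => ζ y - J * ρ y)
      (h1.sub (contDiff_const.mul ρ1)) (h2.sub (ρ2.mul_left))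
      ((tsupport_sub _ _).trans (union_subset h3 ((tsupport_mul_subset_right).trans ρ3)))
      (by rw [integral_sub iζ (iρ.const_mul J), integral_const_mul, ρ4]; ring)
    have e := key η k1 k2 k3
    rw [k4] at e
    simp only [sub_smul, mul_smul] at e
    have a1 := hz.integrable_smul_left_of_hasCompactSupport h1.continuous h2
    have a2 := hz.integrable_smul_left_of_hasCompactSupport ρ1.continuous ρ2
    rw [integral_sub a1 (show Integrable (fun y => J • ρ y • (u y - U y)) from a2.smul J),
      integral_smul] at e
    simp only [smul_sub] at e a1 ⊢
    have a3 : Integrable (fun y => ζ y • c) := iζ.smul_const c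
    rw [integral_sub a1 a3, integral_smul_const]
    simp only [smul_sub] at hcdef
    rw [hcdef]
    exact e
  filter_upwards [hfin] with y hy hy0
  linear_combination hy hy0

theorem locallyIntegrable_indicator_Ioi {u : ℝ → ℂ} (hu : MemLp u 2 (volume.restrict (Ioi 0))) :
    LocallyIntegrable ((Ioi (0 : ℝ)).indicator u) :=
  ((memLp_indicator_iff_restrict measurableSet_Ioi).2 hu).locallyIntegrable (by norm_num)

theorem IsWeakDeriv.exists_isPrimitiveOn {u v : ℝ → ℂ} (hu : MemLp u 2 (volume.restrict (Ioi 0)))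
    (hv : MemLp v 2 (volume.restrict (Ioi 0))) (h : IsWeakDeriv (Ioi 0) u v) :
    ∃ U, IsPrimitiveOn U v (Ici 0) ∧ ∀ᵐ y, y ∈ Ioi (0 : ℝ) → u y = U y := by
  -- Values off the half line are irrelevant to the weak derivative; extension by zero supplies the
  -- global local integrability.
  have h' : IsWeakDeriv (Ioi 0) ((Ioi (0 : ℝ)).indicator u) ((Ioi (0 : ℝ)).indicator v) := by
    intro η h1 h2 h3
    have := h η h1 h2 h3
    rw [integral_eq_setIntegral_Ioi_of_tsupport (tsupport_deriv_subset.trans h3),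
      integral_eq_setIntegral_Ioi_of_tsupport h3] at this ⊢
    have cut (ζ : ℝ → ℝ) (g : ℝ → ℂ) :
        ∫ y in Ioi 0, ζ y • (Ioi (0 : ℝ)).indicator g y = ∫ y in Ioi 0, ζ y • g y :=
      setIntegral_congr_fun measurableSet_Ioi fun y hy => by simp only [indicator_of_mem hy]
    rw [cut, cut, this]
  have lv := locallyIntegrable_indicator_Ioi hv
  obtain ⟨c, hc⟩ := h'.ae_eq_const_add_integral (locallyIntegrable_indicator_Ioi hu) lv
  have hp := (isPrimitiveOn_integral lv.intervalIntegrable (Ici 0))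
  refine ⟨fun y => c + ∫ t in (0 : ℝ)..y, (Ioi (0 : ℝ)).indicator v t, ?_, ?_⟩
  · have hp' : IsPrimitiveOn (fun y => c + ∫ t in (0 : ℝ)..y, (Ioi (0 : ℝ)).indicator v t)
        ((Ioi (0 : ℝ)).indicator v) (Ici 0) := by
      intro a ha b hb
      obtain ⟨i, e⟩ := hp a ha b hb
      exact ⟨i, by rw [e]; ring⟩
    refine hp'.congr_deriv ordConnected_Ici ?_
    filter_upwards [volume.ae_ne (0 : ℝ)] with y hy hy'
    exact indicator_of_mem (lt_of_le_of_ne hy' (Ne.symm hy)) v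
  · filter_upwards [hc] with y hy hy0
    rw [← hy hy0, indicator_of_mem hy0]

/-! ### Solutions on the half line -/

/-- `u ∈ H²(0,∞)` solves `-u'' + q u = f` on the half line, `v` being the derivative of `u`; the
representatives `u`, `v` are continuous on `[0,∞)`. -/
structure IsHalfLineSolution (q : ℝ → ℝ) (u v f : ℝ → ℂ) : Prop where
  memLp : MemLp u 2 (volume.restrict (Ioi 0))
  memLp_deriv : MemLp v 2 (volume.restrict (Ioi 0))
  prim : IsPrimitiveOn u v (Ici 0)
  prim_deriv : IsPrimitiveOn v (fun y => q y * u y - f y) (Ici 0)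

theorem IsHalfLineSolution.add {q : ℝ → ℝ} {u v f u₁ v₁ f₁ : ℝ → ℂ}
    (h : IsHalfLineSolution q u v f) (h₁ : IsHalfLineSolution q u₁ v₁ f₁) :
    IsHalfLineSolution q (fun y => u y + u₁ y) (fun y => v y + v₁ y) (fun y => f y + f₁ y) where
  memLp := h.memLp.add h₁.memLp
  memLp_deriv := h.memLp_deriv.add h₁.memLp_deriv
  prim := h.prim.add h₁.prim
  prim_deriv := by
    convert h.prim_deriv.add h₁.prim_deriv using 2
    ring

theorem IsHalfLineSolution.const_mul {q : ℝ → ℝ} {u v f : ℝ → ℂ} (c : ℂ)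
    (h : IsHalfLineSolution q u v f) :
    IsHalfLineSolution q (fun y => c * u y) (fun y => c * v y) (fun y => c * f y) where
  memLp := h.memLp.const_mul c
  memLp_deriv := h.memLp_deriv.const_mul c
  prim := h.prim.const_mul c
  prim_deriv := by
    convert h.prim_deriv.const_mul c using 2
    ring

/-- A fundamental system `ψ`, `θ` of `-u'' + q u = 0` on the half line in which `ψ` decays and `θ`
grows exponentially. -/
structure HalfLineBasis (q : ℝ → ℝ) where
  ψ : ℝ → ℂ
  dψ : ℝ → ℂ
  θ : ℝ → ℂ
  dθ : ℝ → ℂ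
  slope : ℝ
  rate : ℝ
  bound : ℝ
  rate_pos : 0 < rate
  continuous_ψ : Continuous ψ
  continuous_dψ : Continuous dψ
  continuous_θ : Continuous θ
  continuous_dθ : Continuous dθ
  prim_ψ : IsPrimitiveOn ψ dψ (Ici 0)
  prim_dψ : IsPrimitiveOn dψ (fun y => q y * ψ y) (Ici 0)
  prim_θ : IsPrimitiveOn θ dθ (Ici 0)
  prim_dθ : IsPrimitiveOn dθ (fun y => q y * θ y) (Ici 0)
  ψ_zero : ψ 0 = 1
  dψ_zero : dψ 0 = slope
  θ_zero : θ 0 = 0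
  dθ_zero : dθ 0 = 1
  conj_ψ : ∀ y, (starRingEnd ℂ) (ψ y) = ψ y
  norm_ψ_le : ∀ y, 0 ≤ y → ‖ψ y‖ ≤ bound * Real.exp (-rate * y)
  norm_dψ_le : ∀ y, 0 ≤ y → ‖dψ y‖ ≤ bound * Real.exp (-rate * y)
  norm_θ_le : ∀ y, 0 ≤ y → ‖θ y‖ ≤ bound * Real.exp (rate * y)
  norm_dθ_le : ∀ y, 0 ≤ y → ‖dθ y‖ ≤ bound * Real.exp (rate * y)

theorem memLp_two_of_norm_le_exp {g : ℝ → ℂ} (hg : Continuous g) {M r : ℝ} (hr : 0 < r)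
    (h : ∀ y, 0 ≤ y → ‖g y‖ ≤ M * Real.exp (-r * y)) : MemLp g 2 (volume.restrict (Ioi 0)) := by
  have he : MemLp (fun y : ℝ => M * Real.exp (-r * y)) 2 (volume.restrict (Ioi 0)) := by
    refine MemLp.const_mul ?_ M
    rw [memLp_two_iff_integrable_sq (by fun_prop)]
    have := integrableOn_exp_mul_Ioi (a := -(2 * r)) (by linarith) 0
    refine this.congr (Eventually.of_forall fun y => ?_)
    simp only
    rw [← Real.exp_nat_mul]; congr 1; push_cast; ring
  refine he.mono' hg.aestronglyMeasurable ?_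
  filter_upwards [ae_restrict_mem measurableSet_Ioi] with y hy
  exact h y (le_of_lt hy)

namespace HalfLineBasis

variable {q : ℝ → ℝ} (B : HalfLineBasis q)

theorem bound_nonneg : 0 ≤ B.bound := by
  have := (norm_nonneg _).trans (B.norm_ψ_le 0 le_rfl)
  simpa using this

theorem isHalfLineSolution_ψ : IsHalfLineSolution q B.ψ B.dψ 0 where
  memLp := memLp_two_of_norm_le_exp B.continuous_ψ B.rate_pos B.norm_ψ_le
  memLp_deriv := memLp_two_of_norm_le_exp B.continuous_dψ B.rate_pos B.norm_dψ_le
  prim := B.prim_ψ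
  prim_deriv := by simpa using B.prim_dψ

/-- The Wronskian of two solutions of the homogeneous equation is constant. -/
theorem _root_.TravelingWave.wronskian_eq {u v u₁ v₁ : ℝ → ℂ}
    (h : IsPrimitiveOn u v (Ici 0)) (hd : IsPrimitiveOn v (fun y => q y * u y) (Ici 0))
    (h₁ : IsPrimitiveOn u₁ v₁ (Ici 0)) (hd₁ : IsPrimitiveOn v₁ (fun y => q y * u₁ y) (Ici 0))
    {y : ℝ} (hy : 0 ≤ y) : u y * v₁ y - v y * u₁ y = u 0 * v₁ 0 - v 0 * u₁ 0 := by
  have hw := (h.mul ordConnected_Ici hd₁).sub (hd.mul ordConnected_Ici h₁)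
  have e := (hw 0 self_mem_Ici y hy).2
  rw [intervalIntegral.integral_congr (g := fun _ => 0) (fun t _ => by ring),
    intervalIntegral.integral_zero] at e
  linear_combination -e

theorem wronskian {y : ℝ} (hy : 0 ≤ y) : B.ψ y * B.dθ y - B.dψ y * B.θ y = 1 := by
  rw [wronskian_eq B.prim_ψ B.prim_dψ B.prim_θ B.prim_dθ hy, B.ψ_zero, B.dθ_zero, B.θ_zero]
  ring

/-- The Wronskian of `u` with `ψ` is constant, and integrable on a set of infinite measure as a
combination of products of L² functions, hence zero. The Wronskian with `θ` vanishes because `u` and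
`θ` both vanish at 0. Cramer's rule with the unit Wronskian of `ψ`, `θ` then gives `u = v = 0`. -/
theorem eq_zero_of_isHalfLineSolution (B : HalfLineBasis q) {u v : ℝ → ℂ} (h : IsHalfLineSolution q u v 0)
    (h0 : u 0 = 0) {y : ℝ} (hy : 0 ≤ y) : u y = 0 ∧ v y = 0 := by
  have hd : IsPrimitiveOn v (fun y => q y * u y) (Ici 0) := by simpa using h.prim_deriv
  have w1 (x : ℝ) (hx : 0 ≤ x) := wronskian_eq h.prim hd B.prim_ψ B.prim_dψ hx
  have w2 := wronskian_eq h.prim hd B.prim_θ B.prim_dθ hy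
  rw [h0, B.θ_zero] at w2
  have hC : u 0 * B.dψ 0 - v 0 * B.ψ 0 = 0 := by
    have i : Integrable (fun _ : ℝ => u 0 * B.dψ 0 - v 0 * B.ψ 0) (volume.restrict (Ioi 0)) := by
      refine ((h.memLp.integrable_mul B.isHalfLineSolution_ψ.memLp_deriv).sub
        (h.memLp_deriv.integrable_mul B.isHalfLineSolution_ψ.memLp)).congr ?_
      filter_upwards [ae_restrict_mem measurableSet_Ioi] with x hx
      exact w1 x (le_of_lt hx)
    rw [integrable_const_iff] at i
    rcases i with i | i
    · exact i
    · exact absurd i.measure_univ_lt_top (by simp)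
  have w3 := w1 y hy
  rw [hC] at w3
  have w := B.wronskian hy
  constructor
  · linear_combination (-u y) * w + B.ψ y * w2 - B.θ y * w3
  · linear_combination (-v y) * w + B.dψ y * w2 - B.dθ y * w3

/-- A solution is determined by the right hand side and the value at the origin. -/
theorem isHalfLineSolution_unique (B : HalfLineBasis q) {u v u₁ v₁ f : ℝ → ℂ} (h : IsHalfLineSolution q u v f)
    (h₁ : IsHalfLineSolution q u₁ v₁ f) (h0 : u 0 = u₁ 0) {y : ℝ} (hy : 0 ≤ y) :
    u y = u₁ y ∧ v y = v₁ y := by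
  have hs : IsHalfLineSolution q _ _ _ := h.add (h₁.const_mul (-1))
  have hf : (fun y => f y + -1 * f y) = (0 : ℝ → ℂ) := by ext y; simp
  rw [hf] at hs
  obtain ⟨e, e'⟩ := B.eq_zero_of_isHalfLineSolution hs (by simp [h0]) hy
  constructor
  · linear_combination e
  · linear_combination e'

end HalfLineBasis

/-! ### The Schur test -/

/-- Cauchy–Schwarz after writing k = k^(1/2) k^(1/2), then Tonelli; each of the two marginal bounds
contributes one factor `A`. -/
theorem lintegral_sq_lintegral_mul_le {k : ℝ → ℝ → ℝ≥0∞} (hk : Measurable (Function.uncurry k))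
    {h : ℝ → ℝ≥0∞} (hh : AEMeasurable h) {A : ℝ≥0∞} (h1 : ∀ y, ∫⁻ s, k y s ≤ A)
    (h2 : ∀ s, ∫⁻ y, k y s ≤ A) :
    ∫⁻ y, (∫⁻ s, k y s * h s) ^ (2 : ℝ) ≤ A ^ (2 : ℝ) * ∫⁻ s, h s ^ (2 : ℝ) := by
  have hky (y : ℝ) : Measurable (k y) := hk.comp measurable_prodMk_left
  have step (y : ℝ) : (∫⁻ s, k y s * h s) ^ (2 : ℝ) ≤ A * ∫⁻ s, k y s * h s ^ (2 : ℝ) := by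
    have hH := ENNReal.lintegral_mul_le_Lp_mul_Lq volume Real.HolderConjugate.two_two
      (f := fun s => k y s ^ (1 / 2 : ℝ)) (g := fun s => k y s ^ (1 / 2 : ℝ) * h s)
      ((hky y).pow_const _).aemeasurable (((hky y).pow_const _).aemeasurable.mul hh)
    have e0 (x : ℝ≥0∞) : x ^ (1 / 2 : ℝ) * x ^ (1 / 2 : ℝ) = x := by
      rw [← ENNReal.rpow_add_of_nonneg _ _ (by norm_num) (by norm_num)]
      norm_num
    have e1 (x : ℝ≥0∞) : (x ^ (1 / 2 : ℝ)) ^ (2 : ℝ) = x := by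
      rw [← ENNReal.rpow_mul]; norm_num
    simp only [Pi.mul_apply, ← mul_assoc, e0, ENNReal.mul_rpow_of_nonneg _ _ zero_le_two,
      e1] at hH
    calc (∫⁻ s, k y s * h s) ^ (2 : ℝ)
        ≤ ((∫⁻ s, k y s) ^ (1 / 2 : ℝ) * (∫⁻ s, k y s * h s ^ (2 : ℝ)) ^ (1 / 2 : ℝ)) ^ (2 : ℝ) :=
          ENNReal.rpow_le_rpow hH zero_le_two
      _ = (∫⁻ s, k y s) * ∫⁻ s, k y s * h s ^ (2 : ℝ) := by
          rw [ENNReal.mul_rpow_of_nonneg _ _ zero_le_two, e1, e1]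
      _ ≤ _ := mul_le_mul_left (h1 y) _
  calc ∫⁻ y, (∫⁻ s, k y s * h s) ^ (2 : ℝ)
      ≤ ∫⁻ y, A * ∫⁻ s, k y s * h s ^ (2 : ℝ) := lintegral_mono step
    _ ≤ A * ∫⁻ y, ∫⁻ s, k y s * h s ^ (2 : ℝ) := by
        rw [lintegral_const_mul'']
        exact AEMeasurable.lintegral_prod_right'
          (f := fun p : ℝ × ℝ => k p.1 p.2 * h p.2 ^ (2 : ℝ))
          (hk.aemeasurable.mul ((hh.comp_snd).pow_const _))
    _ = A * ∫⁻ s, ∫⁻ y, k y s * h s ^ (2 : ℝ) := by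
        rw [lintegral_lintegral_swap]
        exact hk.aemeasurable.mul ((hh.comp_snd).pow_const _)
    _ ≤ A * ∫⁻ s, A * h s ^ (2 : ℝ) := by
        refine mul_le_mul_right (lintegral_mono fun s => ?_) _
        simp only
        have hm : Measurable fun y => k y s := hk.comp measurable_prodMk_right
        rw [lintegral_mul_const _ hm]
        exact mul_le_mul_left (h2 s) _
    _ = _ := by
        rw [lintegral_const_mul'' _ (hh.pow_const _), ← mul_assoc, ENNReal.rpow_two, sq]

theorem integral_exp_neg_abs {r : ℝ} (hr : 0 < r) : ∫ x : ℝ, Real.exp (-r * |x|) = 2 / r := by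
  rw [integral_comp_abs (f := fun x => Real.exp (-r * x)), integral_exp_mul_Ioi (by linarith)]
  simp
  ring

theorem integrable_exp_neg_abs {r : ℝ} (hr : 0 < r) :
    Integrable fun x : ℝ => Real.exp (-r * |x|) := by
  -- A non-integrable function would have integral 0 by convention, whereas the value is 2/r > 0.
  by_contra h
  have e := integral_exp_neg_abs hr
  rw [integral_undef h] at e
  have : 0 < 2 / r := by positivity
  linarith

theorem lintegral_exp_neg_abs {r : ℝ} (hr : 0 < r) (y : ℝ) :
    ∫⁻ s, ENNReal.ofReal (Real.exp (-r * |y - s|)) = ENNReal.ofReal (2 / r) := by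
  rw [lintegral_sub_left_eq_self (fun x => ENNReal.ofReal (Real.exp (-r * |x|))) y,
    ← ofReal_integral_eq_lintegral_ofReal (integrable_exp_neg_abs hr)
      (Eventually.of_forall fun x => (Real.exp_pos _).le), integral_exp_neg_abs hr]

/-- A function dominated by the convolution of an exponential with a function in `L²`. -/
theorem eLpNorm_le_of_enorm_le_lintegral_exp {r b : ℝ} (hr : 0 < r) {f F : ℝ → ℂ}
    (hf : AEStronglyMeasurable f)
    (h : ∀ y, ‖F y‖ₑ ≤
      ENNReal.ofReal b * ∫⁻ s, ENNReal.ofReal (Real.exp (-r * |y - s|)) * ‖f s‖ₑ) :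
    eLpNorm F 2 volume ≤ ENNReal.ofReal b * ENNReal.ofReal (2 / r) * eLpNorm f 2 volume := by
  have hS := lintegral_sq_lintegral_mul_le
    (k := fun y s => ENNReal.ofReal (Real.exp (-r * |y - s|))) (A := ENNReal.ofReal (2 / r))
    (by simp only [Function.uncurry_def]; fun_prop) hf.enorm
    (fun y => (lintegral_exp_neg_abs hr y).le)
    (fun s => by
      simp only [abs_sub_comm _ s]
      exact (lintegral_exp_neg_abs hr s).le)
  have h2 : (2 : ℝ≥0∞) ≠ 0 := by norm_num
  have h3 : (2 : ℝ≥0∞) ≠ ⊤ := by norm_num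
  rw [eLpNorm_eq_lintegral_rpow_enorm_toReal h2 h3, eLpNorm_eq_lintegral_rpow_enorm_toReal h2 h3]
  simp only [ENNReal.toReal_ofNat]
  have hm : (∫⁻ y, ‖F y‖ₑ ^ (2 : ℝ)) ≤
      (ENNReal.ofReal b * ENNReal.ofReal (2 / r)) ^ (2 : ℝ) * ∫⁻ s, ‖f s‖ₑ ^ (2 : ℝ) := by
    calc (∫⁻ y, ‖F y‖ₑ ^ (2 : ℝ))
        ≤ ∫⁻ y, ENNReal.ofReal b ^ (2 : ℝ) *
          (∫⁻ s, ENNReal.ofReal (Real.exp (-r * |y - s|)) * ‖f s‖ₑ) ^ (2 : ℝ) := by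
          refine lintegral_mono fun y => ?_
          rw [← ENNReal.mul_rpow_of_nonneg _ _ zero_le_two]
          exact ENNReal.rpow_le_rpow (h y) zero_le_two
      _ = ENNReal.ofReal b ^ (2 : ℝ) * ∫⁻ y,
          (∫⁻ s, ENNReal.ofReal (Real.exp (-r * |y - s|)) * ‖f s‖ₑ) ^ (2 : ℝ) :=
          lintegral_const_mul' _ _ (ENNReal.rpow_ne_top_of_nonneg zero_le_two ENNReal.ofReal_ne_top)
      _ ≤ _ := by
          rw [ENNReal.mul_rpow_of_nonneg _ _ zero_le_two, mul_assoc]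
          exact mul_le_mul_right hS _
  calc _ ≤ ((ENNReal.ofReal b * ENNReal.ofReal (2 / r)) ^ (2 : ℝ) *
        ∫⁻ s, ‖f s‖ₑ ^ (2 : ℝ)) ^ (1 / 2 : ℝ) := ENNReal.rpow_le_rpow hm (by norm_num)
    _ = _ := by
        rw [ENNReal.mul_rpow_of_nonneg _ _ (by norm_num), ← ENNReal.rpow_mul]
        norm_num

theorem memLp_two_exp_neg_abs {r : ℝ} (hr : 0 < r) (y : ℝ) :
    MemLp (fun s : ℝ => Real.exp (-r * |y - s|)) 2 := by
  rw [memLp_two_iff_integrable_sq (by fun_prop)]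
  have := (integrable_exp_neg_abs (r := 2 * r) (by positivity)).comp_sub_left y
  refine this.congr (Eventually.of_forall fun s => ?_)
  simp only
  rw [← Real.exp_nat_mul]; congr 1; push_cast; ring

theorem abs_sub_eq_abs_abs_sub_abs {y s : ℝ} (h : 0 < y * s) : |y - s| = |(|y| - |s|)| := by
  rcases mul_pos_iff.1 h with ⟨h1, h2⟩ | ⟨h1, h2⟩
  · rw [abs_of_pos h1, abs_of_pos h2]
  · rw [abs_of_neg h1, abs_of_neg h2, ← abs_neg]; congr 1; ring

/-! ### The Green operator of the Dirichlet problems on the two half lines. -/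

namespace HalfLineBasis

variable {q : ℝ → ℝ} (B : HalfLineBasis q)

/-- The Green kernel of the two Dirichlet problems on the half lines is `B.kern B.ψ B.θ`, its
derivative in the first variable is `B.kern B.dψ B.dθ`. -/
def kern (a b : ℝ → ℂ) (y s : ℝ) : ℂ :=
  if 0 < y * s then (if |s| ≤ |y| then a |y| * B.θ |s| else b |y| * B.ψ |s|) else 0

theorem measurable_kern {a b : ℝ → ℂ} (ha : Continuous a) (hb : Continuous b) :
    Measurable fun p : ℝ × ℝ => B.kern a b p.1 p.2 := by
  have := B.continuous_ψ
  have := B.continuous_θ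
  unfold kern
  refine Measurable.ite (measurableSet_lt (by fun_prop) (by fun_prop)) ?_ measurable_const
  refine Measurable.ite (measurableSet_le (by fun_prop) (by fun_prop)) ?_ ?_
  · exact Continuous.measurable (by fun_prop)
  · exact Continuous.measurable (by fun_prop)

/-- Exponential bounds for the coefficient functions of a Green kernel. -/
structure IsAdmissible (a b : ℝ → ℂ) : Prop where
  left : Continuous a
  right : Continuous b
  norm_left_le : ∀ y, 0 ≤ y → ‖a y‖ ≤ B.bound * Real.exp (-B.rate * y)
  norm_right_le : ∀ y, 0 ≤ y → ‖b y‖ ≤ B.bound * Real.exp (B.rate * y)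

theorem isAdmissible_basis : B.IsAdmissible B.ψ B.θ :=
  ⟨B.continuous_ψ, B.continuous_θ, B.norm_ψ_le, B.norm_θ_le⟩

theorem isAdmissible_deriv : B.IsAdmissible B.dψ B.dθ :=
  ⟨B.continuous_dψ, B.continuous_dθ, B.norm_dψ_le, B.norm_dθ_le⟩

variable {B} {a b : ℝ → ℂ}

/-- The decaying factor sits at the larger of |y|, |s| and the growing one at the smaller, so the
exponents combine to the difference of absolute values. This equals |y - s| because the kernel
vanishes unless `y` and `s` have the same sign. -/
theorem norm_kern_le (h : B.IsAdmissible a b) (y s : ℝ) :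
    ‖B.kern a b y s‖ ≤ B.bound ^ 2 * Real.exp (-B.rate * |y - s|) := by
  have hM := B.bound_nonneg
  unfold kern
  split_ifs with h1 h2
  · rw [abs_sub_eq_abs_abs_sub_abs h1, abs_of_nonneg (sub_nonneg.2 h2), norm_mul]
    calc _ ≤ B.bound * Real.exp (-B.rate * |y|) * (B.bound * Real.exp (B.rate * |s|)) :=
          mul_le_mul (h.norm_left_le _ (abs_nonneg y)) (B.norm_θ_le _ (abs_nonneg s))
            (norm_nonneg _) (by positivity)
      _ = B.bound ^ 2 * (Real.exp (-B.rate * |y|) * Real.exp (B.rate * |s|)) := by ring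
      _ = _ := by rw [← Real.exp_add]; ring_nf
  · rw [abs_sub_eq_abs_abs_sub_abs h1, abs_of_neg (sub_neg.2 (not_le.1 h2)), norm_mul]
    calc _ ≤ B.bound * Real.exp (B.rate * |y|) * (B.bound * Real.exp (-B.rate * |s|)) :=
          mul_le_mul (h.norm_right_le _ (abs_nonneg y)) (B.norm_ψ_le _ (abs_nonneg s))
            (norm_nonneg _) (by positivity)
      _ = B.bound ^ 2 * (Real.exp (B.rate * |y|) * Real.exp (-B.rate * |s|)) := by ring
      _ = _ := by rw [← Real.exp_add]; ring_nf
  · rw [norm_zero]; positivity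

theorem integrable_kern_mul (h : B.IsAdmissible a b) {f : ℝ → ℂ} (hf : MemLp f 2 volume) (y : ℝ) :
    Integrable fun s => B.kern a b y s * f s := by
  have i := ((memLp_two_exp_neg_abs B.rate_pos y).const_mul (B.bound ^ 2)).integrable_mul hf.norm
  refine i.mono' ((((B.measurable_kern h.left h.right).comp
    measurable_prodMk_left).aestronglyMeasurable).mul hf.1) (Eventually.of_forall fun s => ?_)
  rw [norm_mul]
  exact mul_le_mul_of_nonneg_right (norm_kern_le h y s) (norm_nonneg _)

variable (B a b) in
/-- The integral operator with kernel `B.kern a b`. -/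
def green (f : ℝ → ℂ) (y : ℝ) : ℂ := ∫ s, B.kern a b y s * f s

theorem enorm_green_le (h : B.IsAdmissible a b) (f : ℝ → ℂ) (y : ℝ) :
    ‖B.green a b f y‖ₑ ≤ ENNReal.ofReal (B.bound ^ 2) *
      ∫⁻ s, ENNReal.ofReal (Real.exp (-B.rate * |y - s|)) * ‖f s‖ₑ := by
  refine (enorm_integral_le_lintegral_enorm _).trans ?_
  rw [← lintegral_const_mul' _ _ ENNReal.ofReal_ne_top]
  refine lintegral_mono fun s => ?_
  simp only
  rw [enorm_mul, ← mul_assoc, ← ENNReal.ofReal_mul (sq_nonneg _), ← ofReal_norm]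
  exact mul_le_mul_left (ENNReal.ofReal_le_ofReal (norm_kern_le h y s)) _

theorem aestronglyMeasurable_green (h : B.IsAdmissible a b) {f : ℝ → ℂ}
    (hf : AEStronglyMeasurable f) : AEStronglyMeasurable (B.green a b f) :=
  AEStronglyMeasurable.integral_prod_right'
    (f := fun p : ℝ × ℝ => B.kern a b p.1 p.2 * f p.2)
    ((B.measurable_kern h.left h.right).aestronglyMeasurable.mul hf.comp_snd)

theorem eLpNorm_green_le (h : B.IsAdmissible a b) {f : ℝ → ℂ} (hf : MemLp f 2 volume) :
    eLpNorm (B.green a b f) 2 volume ≤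
      ENNReal.ofReal (B.bound ^ 2) * ENNReal.ofReal (2 / B.rate) * eLpNorm f 2 volume :=
  eLpNorm_le_of_enorm_le_lintegral_exp B.rate_pos hf.1 (enorm_green_le h f)

theorem memLp_green (h : B.IsAdmissible a b) {f : ℝ → ℂ} (hf : MemLp f 2 volume) :
    MemLp (B.green a b f) 2 volume :=
  ⟨aestronglyMeasurable_green h hf.1, (eLpNorm_green_le h hf).trans_lt
    (ENNReal.mul_lt_top (ENNReal.mul_lt_top ENNReal.ofReal_lt_top ENNReal.ofReal_lt_top) hf.2)⟩

theorem green_congr {f g : ℝ → ℂ} (h : f =ᵐ[volume] g) : B.green a b f = B.green a b g :=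
  funext fun y => integral_congr_ae (h.mono fun s hs => by simp only [hs])

variable (B) in
/-- The solution operator of the Dirichlet problems on the two half lines. -/
def dirichlet : L2 →L[ℂ] L2 :=
  LinearMap.mkContinuous
    { toFun := fun f => (memLp_green B.isAdmissible_basis (Lp.memLp f)).toLp
      map_add' := fun f g => by
        apply Lp.ext
        filter_upwards [MemLp.coeFn_toLp (memLp_green B.isAdmissible_basis (Lp.memLp (f + g))),
          MemLp.coeFn_toLp (memLp_green B.isAdmissible_basis (Lp.memLp f)),
          MemLp.coeFn_toLp (memLp_green B.isAdmissible_basis (Lp.memLp g)),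
          Lp.coeFn_add (memLp_green B.isAdmissible_basis (Lp.memLp f)).toLp
            (memLp_green B.isAdmissible_basis (Lp.memLp g)).toLp] with y e1 e2 e3 e4
        rw [e1, e4, Pi.add_apply, e2, e3, green_congr (Lp.coeFn_add f g)]
        unfold green
        rw [← integral_add (integrable_kern_mul B.isAdmissible_basis (Lp.memLp f) y)
          (integrable_kern_mul B.isAdmissible_basis (Lp.memLp g) y)]
        simp only [Pi.add_apply, mul_add]
      map_smul' := fun c f => by
        apply Lp.ext
        filter_upwards [MemLp.coeFn_toLp (memLp_green B.isAdmissible_basis (Lp.memLp (c • f))),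
          MemLp.coeFn_toLp (memLp_green B.isAdmissible_basis (Lp.memLp f)),
          Lp.coeFn_smul c (memLp_green B.isAdmissible_basis (Lp.memLp f)).toLp] with y e1 e2 e3
        rw [e1, RingHom.id_apply, e3, Pi.smul_apply, e2, green_congr (Lp.coeFn_smul c f)]
        unfold green
        rw [smul_eq_mul, ← integral_const_mul]
        congr 1
        ext s
        simp only [Pi.smul_apply, smul_eq_mul]
        ring }
    (B.bound ^ 2 * (2 / B.rate)) fun f => by
      have hr := B.rate_pos
      have hM := B.bound_nonneg
      have hb := eLpNorm_green_le B.isAdmissible_basis (Lp.memLp f)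
      have := ENNReal.toReal_mono (ENNReal.mul_ne_top (ENNReal.mul_ne_top ENNReal.ofReal_ne_top
        ENNReal.ofReal_ne_top) (Lp.eLpNorm_ne_top f)) hb
      simp only [LinearMap.coe_mk, AddHom.coe_mk]
      rw [Lp.norm_toLp, Lp.norm_def]
      rwa [ENNReal.toReal_mul, ENNReal.toReal_mul, ENNReal.toReal_ofReal (by positivity),
        ENNReal.toReal_ofReal (by positivity)] at this

variable (B) in
theorem coeFn_dirichlet (f : L2) : B.dirichlet f =ᵐ[volume] B.green B.ψ B.θ f :=
  MemLp.coeFn_toLp (memLp_green B.isAdmissible_basis (Lp.memLp f))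

/-! ### The Green integral as a solution on the half line -/

variable (B a b) in
/-- The variation of constants formula on the half line. -/
def variation (f : ℝ → ℂ) (y : ℝ) : ℂ :=
  a y * (∫ s in (0 : ℝ)..y, B.θ s * f s) + b y * ∫ s in Ioi y, B.ψ s * f s

theorem green_eq_variation (h : B.IsAdmissible a b) {f : ℝ → ℂ} (hf : MemLp f 2 volume) {y : ℝ}
    (hy : 0 < y) : B.green a b f y = B.variation a b f y := by
  have i := integrable_kern_mul h hf y
  have e : B.green a b f y = ∫ s in Ioi 0, B.kern a b y s * f s := by
    refine (setIntegral_eq_integral_of_forall_compl_eq_zero fun s hs => ?_).symm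
    have : ¬ 0 < y * s := not_lt.2 (mul_nonpos_of_nonneg_of_nonpos hy.le (not_lt.1 hs))
    simp [kern, this]
  rw [e, ← Ioc_union_Ioi_eq_Ioi hy.le, setIntegral_union (Ioc_disjoint_Ioi le_rfl)
    measurableSet_Ioi i.integrableOn i.integrableOn]
  unfold variation
  rw [intervalIntegral.integral_of_le hy.le, ← integral_const_mul, ← integral_const_mul]
  congr 1
  · refine setIntegral_congr_fun measurableSet_Ioc fun s hs => ?_
    simp only [kern]
    rw [if_pos (mul_pos hy hs.1), abs_of_pos hs.1, abs_of_pos hy, if_pos hs.2]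
    ring
  · refine setIntegral_congr_fun measurableSet_Ioi fun s hs => ?_
    have hs' : y < s := hs
    simp only [kern]
    rw [if_pos (mul_pos hy (hy.trans hs)), abs_of_pos (hy.trans hs), abs_of_pos hy,
      if_neg (not_le.2 hs')]
    ring

/-- The kernel is invariant under (y, s) ↦ (-y, -s), so the negative half line needs no separate
treatment. -/
theorem green_neg (f : ℝ → ℂ) (y : ℝ) :
    B.green a b f (-y) = B.green a b (fun s => f (-s)) y := by
  unfold green
  rw [← integral_neg_eq_self]
  simp [kern]

/-- Variation of constants: on differentiating once the two terms containing `f` cancel; on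
differentiating again they combine to `-f` through the Wronskian. Square integrability comes from
the Schur bound, as the formula agrees with the Green integral for y > 0. -/
theorem isHalfLineSolution_variation {f : ℝ → ℂ} (hf : MemLp f 2 volume) :
    IsHalfLineSolution q (B.variation B.ψ B.θ f) (B.variation B.dψ B.dθ f) f := by
  have hloc : LocallyIntegrable f := hf.locallyIntegrable (by norm_num)
  have iθ (a b : ℝ) : IntervalIntegrable (fun s => B.θ s * f s) volume a b :=
    (hloc.intervalIntegrable a b).continuousOn_mul B.continuous_θ.continuousOn
  have iψ (a b : ℝ) : IntervalIntegrable (fun s => B.ψ s * f s) volume a b :=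
    (hloc.intervalIntegrable a b).continuousOn_mul B.continuous_ψ.continuousOn
  have jψ : IntegrableOn (fun s => B.ψ s * f s) (Ioi 0) :=
    B.isHalfLineSolution_ψ.memLp.integrable_mul (hf.restrict _)
  have hP := isPrimitiveOn_integral iθ (Ici 0)
  have hQ : IsPrimitiveOn (fun y => ∫ s in Ioi y, B.ψ s * f s) (fun y => -1 * (B.ψ y * f y))
      (Ici 0) := by
    have h0 := (isPrimitiveOn_integral iψ (Ici 0)).const_mul (-1)
    have h1 : IsPrimitiveOn (fun y => (∫ s in Ioi 0, B.ψ s * f s) +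
        -1 * ∫ s in (0 : ℝ)..y, B.ψ s * f s) (fun y => -1 * (B.ψ y * f y)) (Ici 0) := by
      intro a ha b hb
      obtain ⟨i, e⟩ := h0 a ha b hb
      exact ⟨i, by rw [e]; ring⟩
    refine h1.congr fun y hy => ?_
    have hy' : (0 : ℝ) ≤ y := hy
    have := intervalIntegral.integral_interval_add_Ioi jψ (jψ.mono_set (Ioi_subset_Ioi hy'))
    rw [← this]; ring
  have green_memLp {a b : ℝ → ℂ} (h : B.IsAdmissible a b) :
      MemLp (B.variation a b f) 2 (volume.restrict (Ioi 0)) := by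
    refine ((memLp_green h hf).restrict (Ioi 0)).ae_eq ?_
    filter_upwards [ae_restrict_mem measurableSet_Ioi] with y hy
    exact green_eq_variation h hf hy
  refine ⟨green_memLp B.isAdmissible_basis, green_memLp B.isAdmissible_deriv, ?_, ?_⟩
  · refine ((B.prim_ψ.mul ordConnected_Ici hP).add
      (B.prim_θ.mul ordConnected_Ici hQ)).congr_deriv ordConnected_Ici
      (Eventually.of_forall fun y _ => ?_)
    unfold variation
    ring
  · refine ((B.prim_dψ.mul ordConnected_Ici hP).add
      (B.prim_dθ.mul ordConnected_Ici hQ)).congr_deriv ordConnected_Ici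
      (Eventually.of_forall fun y hy => ?_)
    unfold variation
    linear_combination (-f y) * B.wronskian hy

theorem variation_zero (f : ℝ → ℂ) : B.variation B.ψ B.θ f 0 = 0 := by
  simp [variation, B.θ_zero]

theorem variation_deriv_zero (f : ℝ → ℂ) :
    B.variation B.dψ B.dθ f 0 = ∫ s in Ioi 0, B.ψ s * f s := by
  simp [variation, B.dθ_zero]

end HalfLineBasis

/-! ### Reflection at the origin -/

theorem ae_neg {P : ℝ → Prop} (h : ∀ᵐ y, P y) : ∀ᵐ y, P (-y) :=
  (Measure.measurePreserving_neg (volume : Measure ℝ)).quasiMeasurePreserving.tendsto_ae.eventually h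

theorem ae_of_pos_of_neg {P : ℝ → Prop} (h₁ : ∀ᵐ y, 0 < y → P y) (h₂ : ∀ᵐ y, 0 < y → P (-y)) :
    ∀ᵐ y, P y := by
  filter_upwards [h₁, ae_neg h₂, volume.ae_ne (0 : ℝ)] with y k₁ k₂ k₃
  rcases lt_or_gt_of_ne k₃ with hy | hy
  · simpa using k₂ (by linarith)
  · exact k₁ hy

theorem deriv_comp_neg' (η : ℝ → ℝ) (y : ℝ) :
    deriv (fun x => η (-x)) y = - deriv η (-y) := deriv_comp_neg η y

theorem hasCompactSupport_comp_neg {η : ℝ → ℝ} (h : HasCompactSupport η) :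
    HasCompactSupport fun x => η (-x) :=
  h.comp_homeomorph (Homeomorph.neg ℝ)

theorem IsWeakDeriv.comp_neg {U : Set ℝ} {u v : ℝ → ℂ} (h : IsWeakDeriv U u v) (hU : -U = U) :
    IsWeakDeriv U (fun y => u (-y)) (fun y => - v (-y)) := by
  intro η h1 h2 h3
  have e := h (fun x => η (-x)) (h1.comp contDiff_neg) (hasCompactSupport_comp_neg h2) (by
    have : tsupport (fun x => η (-x)) = -tsupport η :=
      tsupport_comp_eq_preimage η (Homeomorph.neg ℝ)
    rw [this, ← hU]
    exact neg_subset_neg.2 h3)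
  rw [← integral_neg_eq_self, ← integral_neg_eq_self (fun y => η (-y) • v y)] at e
  simp only [deriv_comp_neg', neg_neg, neg_smul, integral_neg] at e
  simp only [smul_neg, integral_neg, neg_neg]
  linear_combination -e

theorem IsWeakDeriv.mono {U U' : Set ℝ} {u v : ℝ → ℂ} (h : IsWeakDeriv U u v) (hU : U' ⊆ U) :
    IsWeakDeriv U' u v := fun η h1 h2 h3 => h η h1 h2 (h3.trans hU)

theorem HasTrace.comp_neg {u : ℝ → ℂ} {a : ℂ} (h : HasTrace (𝓝[<] 0) u a) :
    HasTrace (𝓝[>] 0) (fun y => u (-y)) a := by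
  refine Tendsto.comp (g := u) h (tendsto_inf.2 ⟨?_, ?_⟩)
  · have : Tendsto (fun y : ℝ => -y) (𝓝[>] 0) (𝓝[<] (-0)) := tendsto_neg_nhdsGT
    rw [neg_zero] at this
    exact this.mono_left inf_le_left
  · exact (Measure.measurePreserving_neg
      (volume : Measure ℝ)).quasiMeasurePreserving.tendsto_ae.mono_left inf_le_right

theorem HasTrace.of_comp_neg {u : ℝ → ℂ} {a : ℂ} (h : HasTrace (𝓝[>] 0) (fun y => u (-y)) a) :
    HasTrace (𝓝[<] 0) u a := by
  have e : u = fun y => (fun x => u (-x)) (-y) := by ext y; simp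
  rw [e]
  refine Tendsto.comp (g := fun x => u (-x)) h (tendsto_inf.2 ⟨?_, ?_⟩)
  · have : Tendsto (fun y : ℝ => -y) (𝓝[<] 0) (𝓝[>] (-0)) := tendsto_neg_nhdsLT
    rw [neg_zero] at this
    exact this.mono_left inf_le_left
  · exact (Measure.measurePreserving_neg
      (volume : Measure ℝ)).quasiMeasurePreserving.tendsto_ae.mono_left inf_le_right

theorem HasTrace.mono {l l' : Filter ℝ} {u : ℝ → ℂ} {a : ℂ} (h : HasTrace l u a) (hl : l' ≤ l) :
    HasTrace l' u a := Tendsto.mono_left h (inf_le_inf_right _ hl)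

theorem memLp_comp_neg {u : ℝ → ℂ} (h : MemLp u 2 volume) :
    MemLp (fun y => u (-y)) 2 volume :=
  h.comp_measurePreserving (Measure.measurePreserving_neg volume)

/-! ### Traces of primitives -/

/-- Without this, limits along the filter, and hence one-sided traces, would not be unique. -/
instance neBot_nhdsGT_inf_ae : (𝓝[>] (0 : ℝ) ⊓ ae volume).NeBot := by
  rw [inf_neBot_iff]
  intro s hs t ht
  obtain ⟨e, he, hsub⟩ := mem_nhdsGT_iff_exists_Ioo_subset.1 hs
  have he' : (0 : ℝ) < e := he
  by_contra hne
  rw [not_nonempty_iff_eq_empty] at hne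
  have h0 : volume (Ioo 0 e) = 0 := by
    refine measure_mono_null (t := tᶜ) (fun y hy hyt => ?_) (mem_ae_iff.1 ht)
    exact notMem_empty y (hne ▸ ⟨hsub hy, hyt⟩)
  rw [Real.volume_Ioo, ENNReal.ofReal_eq_zero] at h0
  linarith

theorem IsPrimitiveOn.hasTrace {u U V : ℝ → ℂ} (h : IsPrimitiveOn U V (Ici 0))
    (e : ∀ᵐ y, 0 < y → u y = U y) : HasTrace (𝓝[>] 0) u (U 0) := by
  have h1 : Tendsto U (𝓝[>] 0 ⊓ ae volume) (𝓝 (U 0)) := by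
    have := h.continuousOn_Ici 0 self_mem_Ici
    exact (this.mono_left (nhdsWithin_mono _ Ioi_subset_Ici_self)).mono_left inf_le_left
  refine h1.congr' ?_
  filter_upwards [(e.filter_mono inf_le_right : ∀ᶠ y in 𝓝[>] 0 ⊓ ae volume, 0 < y → u y = U y),
    (eventually_mem_nhdsWithin.filter_mono inf_le_left :
      ∀ᶠ y in 𝓝[>] (0 : ℝ) ⊓ ae volume, y ∈ Ioi 0)] with y k₁ k₂
  exact (k₁ k₂).symm

/-! ### Restriction to the half lines and gluing -/

theorem exists_isHalfLineSolution {q : ℝ → ℝ} {u v w f : ℝ → ℂ}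
    (hu : MemLp u 2 (volume.restrict (Ioi 0))) (hv : MemLp v 2 (volume.restrict (Ioi 0)))
    (hw : MemLp w 2 (volume.restrict (Ioi 0))) (h₁ : IsWeakDeriv (Ioi 0) u v)
    (h₂ : IsWeakDeriv (Ioi 0) v w) (he : ∀ᵐ y, 0 < y → f y = - w y + q y * u y) :
    ∃ U V, IsHalfLineSolution q U V f ∧ (∀ᵐ y, 0 < y → u y = U y) ∧
      ∀ᵐ y, 0 < y → v y = V y := by
  obtain ⟨U, pU, eU⟩ := h₁.exists_isPrimitiveOn hu hv
  obtain ⟨V, pV, eV⟩ := h₂.exists_isPrimitiveOn hv hw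
  refine ⟨U, V, ⟨?_, ?_, ?_, ?_⟩, eU, eV⟩
  · exact hu.ae_eq ((ae_restrict_iff' measurableSet_Ioi).2 eU)
  · exact hv.ae_eq ((ae_restrict_iff' measurableSet_Ioi).2 eV)
  · refine pU.congr_deriv ordConnected_Ici ?_
    filter_upwards [eV, volume.ae_ne (0 : ℝ)] with y k₁ k₂ k₃
    exact k₁ (lt_of_le_of_ne k₃ k₂.symm)
  · refine pV.congr_deriv ordConnected_Ici ?_
    filter_upwards [eU, he, volume.ae_ne (0 : ℝ)] with y k₁ k₂ k₃ k₄
    have hy : 0 < y := lt_of_le_of_ne k₄ k₃.symm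
    rw [← k₁ hy, k₂ hy]; ring

/-- Integration by parts for a function glued from two primitives on the half lines. -/
theorem integral_deriv_smul_eq_of_glued {u v U V U₁ V₁ : ℝ → ℂ} (hu : LocallyIntegrable u)
    (hv : LocallyIntegrable v) (h : IsPrimitiveOn U V (Ici 0)) (h₁ : IsPrimitiveOn U₁ V₁ (Ici 0))
    (eu : ∀ᵐ y, 0 < y → u y = U y) (eu₁ : ∀ᵐ y, 0 < y → u (-y) = U₁ y)
    (ev : ∀ᵐ y, 0 < y → v y = V y) (ev₁ : ∀ᵐ y, 0 < y → v (-y) = - V₁ y)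
    {η : ℝ → ℝ} (hη : ContDiff ℝ ∞ η) (hc : HasCompactSupport η) :
    ∫ y, deriv η y • u y = η 0 • (U₁ 0 - U 0) - ∫ y, η y • v y := by
  have c' : Continuous (deriv η) := hη.continuous_deriv (by simp)
  have split (ζ : ℝ → ℝ) (g G G₁ : ℝ → ℂ) (ig : Integrable fun y => ζ y • g y)
      (e : ∀ᵐ y, 0 < y → g y = G y) (e₁ : ∀ᵐ y, 0 < y → g (-y) = G₁ y) :
      ∫ y, ζ y • g y = (∫ y in Ioi 0, ζ y • G y) + ∫ y in Ioi 0, ζ (-y) • G₁ y := by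
    rw [← integral_add_compl measurableSet_Ioi ig]
    congr 1
    · exact setIntegral_congr_ae measurableSet_Ioi (e.mono fun y hy h0 => by rw [hy h0])
    · rw [compl_Ioi, ← neg_zero, ← integral_comp_neg_Ioi, neg_zero]
      exact setIntegral_congr_ae measurableSet_Ioi (e₁.mono fun y hy h0 => by rw [hy h0])
  rw [split _ u U U₁ (hu.integrable_smul_left_of_hasCompactSupport c' hc.deriv) eu eu₁,
    split _ v V (fun y => - V₁ y)
      (hv.integrable_smul_left_of_hasCompactSupport hη.continuous hc) ev ev₁,
    h.integral_deriv_smul hη hc]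
  have e := h₁.integral_deriv_smul (η := fun x => η (-x)) (hη.comp contDiff_neg)
    (hasCompactSupport_comp_neg hc)
  simp only [deriv_comp_neg', neg_smul, integral_neg, neg_zero] at e
  simp only [smul_neg, integral_neg, smul_sub]
  linear_combination -e

/-- `u` is glued from two solutions on the half lines that agree at the origin, the jump of the
derivative being `-c` times the value. -/
def IsGluedSolution (q : ℝ → ℝ) (c : ℝ) (u f : L2) : Prop :=
  ∃ U V U₁ V₁ : ℝ → ℂ, IsHalfLineSolution q U V f ∧ IsHalfLineSolution q U₁ V₁ (fun y => f (-y)) ∧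
    (∀ᵐ y, 0 < y → u y = U y) ∧ (∀ᵐ y, 0 < y → u (-y) = U₁ y) ∧
    U 0 = U₁ 0 ∧ V 0 + V₁ 0 = - c * U 0

theorem locallyIntegrable_L2 (u : L2) : LocallyIntegrable (u : ℝ → ℂ) :=
  (Lp.memLp u).locallyIntegrable (by norm_num)

theorem exists_isHalfLineSolution_pair {q : ℝ → ℝ} (hq : ∀ y, q (-y) = q y) {u v w f : L2}
    (h₁ : IsWeakDeriv univ u v) (h₂ : IsWeakDeriv {0}ᶜ v w)
    (he : (f : ℝ → ℂ) =ᵐ[volume] fun y => - w y + q y * u y) :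
    ∃ U V U₁ V₁ : ℝ → ℂ, IsHalfLineSolution q U V f ∧
      IsHalfLineSolution q U₁ V₁ (fun y => f (-y)) ∧
      (∀ᵐ y, 0 < y → u y = U y) ∧ (∀ᵐ y, 0 < y → u (-y) = U₁ y) ∧
      (∀ᵐ y, 0 < y → v y = V y) ∧ (∀ᵐ y, 0 < y → v (-y) = - V₁ y) := by
  have mu := Lp.memLp u
  have mv := Lp.memLp v
  have mw := Lp.memLp w
  have hsub : Ioi (0 : ℝ) ⊆ {0}ᶜ := fun y hy => (ne_of_gt hy : y ≠ 0)
  obtain ⟨U, V, s, e, e'⟩ := exists_isHalfLineSolution (q := q) (f := f) (mu.restrict _)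
    (mv.restrict _) (mw.restrict _)
    (h₁.mono (subset_univ _)) (h₂.mono hsub) (he.mono fun y hy _ => hy)
  have k₁ := h₁.comp_neg (by simp)
  have k₂ := h₂.comp_neg (by simp)
  have k₂' : IsWeakDeriv {0}ᶜ (fun y => - v (-y)) (fun y => w (-y)) := by
    intro η a b c
    have := k₂ η a b c
    simp only [smul_neg, integral_neg] at this ⊢
    rw [this, neg_neg]
  obtain ⟨U₁, V₁, s₁, e₁, e₁'⟩ := exists_isHalfLineSolution (q := q) (f := fun y => f (-y))
    (memLp_comp_neg mu |>.restrict _) ((memLp_comp_neg mv).neg.restrict _)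
    (memLp_comp_neg mw |>.restrict _) (k₁.mono (subset_univ _)) (k₂'.mono hsub)
    ((ae_neg he).mono fun y hy _ => by simp only [hy, hq])
  refine ⟨U, V, U₁, V₁, s, s₁, e, e₁, e', e₁'.mono fun y hy h0 => ?_⟩
  rw [← hy h0, Pi.neg_apply, neg_neg]

theorem isGluedSolution_of_mem_deltaGraph {q : ℝ → ℝ} (hq : ∀ y, q (-y) = q y) {c : ℝ} {u f : L2}
    (h : (u, f) ∈ deltaGraph q c) : IsGluedSolution q c u f := by
  obtain ⟨v, w, a, r, l, h₁, h₂, ta, tr, tl, hj, he⟩ := h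
  obtain ⟨U, V, U₁, V₁, s, s₁, e, e₁, e', e₁'⟩ := exists_isHalfLineSolution_pair hq h₁ h₂ he
  have a1 : U 0 = a := tendsto_nhds_unique (s.prim.hasTrace e)
    (ta.mono (nhdsWithin_mono _ fun y hy => (ne_of_gt hy : y ≠ 0)))
  have a2 : U₁ 0 = a := tendsto_nhds_unique (s₁.prim.hasTrace e₁)
    (ta.mono (nhdsWithin_mono _ fun y hy => (ne_of_lt hy : y ≠ 0)) :
      HasTrace (𝓝[<] 0) u a).comp_neg
  have a3 : V 0 = r := tendsto_nhds_unique (s.prim_deriv.hasTrace e') tr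
  -- `V₁` differentiates the reflected function, so the left derivative at 0 is `-V₁ 0` and the jump
  -- is the sum `V 0 + V₁ 0`.
  have a4 : -1 * V₁ 0 = l := tendsto_nhds_unique
    ((s₁.prim_deriv.const_mul (-1)).hasTrace (u := fun y => v (-y))
      (e₁'.mono fun y hy h0 => by rw [hy h0]; ring)) tl.comp_neg
  refine ⟨U, V, U₁, V₁, s, s₁, e, e₁, a1.trans a2.symm, ?_⟩
  rw [a3, a1, ← hj, ← a4]; ring

/-- No trace conditions are built into this graph. They are recovered by testing with a bump equal
to 1 at the origin: the boundary terms of the glued integration by parts must vanish, once for `u`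
and once for `v`. -/
theorem isGluedSolution_of_mem_regularGraph {q : ℝ → ℝ} (hq : ∀ y, q (-y) = q y) {u f : L2}
    (h : (u, f) ∈ regularGraph q) : IsGluedSolution q 0 u f := by
  obtain ⟨v, w, h₁, h₂, he⟩ := h
  obtain ⟨U, V, U₁, V₁, s, s₁, e, e₁, e', e₁'⟩ :=
    exists_isHalfLineSolution_pair hq h₁ (h₂.mono (subset_univ _)) he
  let bump : ContDiffBump (0 : ℝ) := ⟨1, 2, by norm_num, by norm_num⟩
  have b0 : bump 0 = 1 := bump.one_of_mem_closedBall (by simp [bump])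
  have b1 : ContDiff ℝ ∞ bump := bump.contDiff
  have b2 : HasCompactSupport bump := bump.hasCompactSupport
  have lu := locallyIntegrable_L2 u
  have lv := locallyIntegrable_L2 v
  have lw := locallyIntegrable_L2 w
  have g1 := integral_deriv_smul_eq_of_glued lu lv s.prim s₁.prim e e₁ e' e₁' b1 b2
  have g2 := integral_deriv_smul_eq_of_glued lv lw s.prim_deriv
    (s₁.prim_deriv.const_mul (-1)) e' (e₁'.mono fun y hy h0 => by rw [hy h0]; ring)
    (by filter_upwards [he, e] with y k₁ k₂ h0
        rw [← k₂ h0, k₁]; ring)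
    (by filter_upwards [ae_neg he, e₁] with y k₁ k₂ h0
        rw [← k₂ h0, k₁, hq]; ring) b1 b2
  rw [h₁ _ b1 b2 (subset_univ _), b0, one_smul] at g1
  rw [h₂ _ b1 b2 (subset_univ _), b0, one_smul] at g2
  refine ⟨U, V, U₁, V₁, s, s₁, e, e₁, by linear_combination g1, ?_⟩
  push_cast
  linear_combination g2

theorem exists_L2_glue {V V₁ : ℝ → ℂ} (h : MemLp V 2 (volume.restrict (Ioi 0)))
    (h₁ : MemLp V₁ 2 (volume.restrict (Ioi 0))) :
    ∃ v : L2, (∀ᵐ y, 0 < y → v y = V y) ∧ ∀ᵐ y, 0 < y → v (-y) = V₁ y := by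
  have m := (memLp_indicator_iff_restrict measurableSet_Ioi).2 h
  have m₁ := memLp_comp_neg ((memLp_indicator_iff_restrict measurableSet_Ioi).2 h₁)
  have e := (m.add m₁).coeFn_toLp
  refine ⟨(m.add m₁).toLp, ?_, ?_⟩
  · filter_upwards [e] with y hy h0
    rw [hy]
    simp [h0, h0.le]
  · filter_upwards [ae_neg e] with y hy h0
    rw [hy]
    simp [h0, h0.le]

theorem exists_L2_secondDeriv {q : ℝ → ℝ} (hqm : Measurable q) {K : ℝ} (hqb : ∀ y, |q y| ≤ K)
    (u f : L2) : ∃ w : L2, (f : ℝ → ℂ) =ᵐ[volume] fun y => - w y + q y * u y := by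
  have m : MemLp (fun y => (q y : ℂ) * u y - f y) 2 volume := by
    refine MemLp.sub ?_ (Lp.memLp f)
    refine ((Lp.memLp u).const_mul (K : ℂ)).mono
      ((Complex.measurable_ofReal.comp hqm).aestronglyMeasurable.mul (Lp.memLp u).1)
      (Eventually.of_forall fun y => ?_)
    rw [norm_mul, norm_mul, Complex.norm_real, Complex.norm_real, Real.norm_eq_abs,
      Real.norm_eq_abs]
    exact mul_le_mul_of_nonneg_right ((hqb y).trans (le_abs_self K)) (norm_nonneg _)
  refine ⟨m.toLp, ?_⟩
  filter_upwards [m.coeFn_toLp] with y hy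
  rw [hy]; ring

/-- Serves both operators at once: in the second integration by parts the boundary term at 0
vanishes either because the test function does, or because `c = 0` removes the jump. -/
theorem IsGluedSolution.exists_weakDeriv {q : ℝ → ℝ} (hq : ∀ y, q (-y) = q y) (hqm : Measurable q)
    {K : ℝ} (hqb : ∀ y, |q y| ≤ K) {c : ℝ} {u f : L2} (h : IsGluedSolution q c u f) :
    ∃ v w : L2, ∃ a r l : ℂ, IsWeakDeriv univ u v ∧ IsWeakDeriv {0}ᶜ v w ∧
      (c = 0 → IsWeakDeriv univ v w) ∧
      HasTrace (𝓝[≠] 0) u a ∧ HasTrace (𝓝[>] 0) v r ∧ HasTrace (𝓝[<] 0) v l ∧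
      r - l = - c * a ∧ (f : ℝ → ℂ) =ᵐ[volume] fun y => - w y + q y * u y := by
  obtain ⟨U, V, U₁, V₁, s, s₁, e, e₁, h0, hj⟩ := h
  obtain ⟨v, ev, ev₁⟩ := exists_L2_glue s.memLp_deriv s₁.memLp_deriv.neg
  obtain ⟨w, he⟩ := exists_L2_secondDeriv hqm hqb u f
  have lu := locallyIntegrable_L2 u
  have lv := locallyIntegrable_L2 v
  have lw := locallyIntegrable_L2 w
  have ev₁' : ∀ᵐ y, 0 < y → v (-y) = -1 * V₁ y :=
    ev₁.mono fun y hy h0 => by rw [hy h0, Pi.neg_apply]; ring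
  have g2 {η : ℝ → ℝ} (b1 : ContDiff ℝ ∞ η) (b2 : HasCompactSupport η) :=
    integral_deriv_smul_eq_of_glued lv lw s.prim_deriv (s₁.prim_deriv.const_mul (-1)) ev ev₁'
    (by filter_upwards [he, e] with y k₁ k₂ h0
        rw [← k₂ h0, k₁]; ring)
    (by filter_upwards [ae_neg he, e₁] with y k₁ k₂ h0
        rw [← k₂ h0, k₁, hq]; ring) b1 b2
  refine ⟨v, w, U 0, V 0, -1 * V₁ 0, ?_, ?_, ?_, ?_, ?_, ?_, ?_, he⟩
  · intro η b1 b2 _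
    rw [integral_deriv_smul_eq_of_glued lu lv s.prim s₁.prim e e₁ ev
      (ev₁.mono fun y hy h0 => by rw [hy h0, Pi.neg_apply]) b1 b2, h0]
    simp
  · intro η b1 b2 b3
    have hη0 : η 0 = 0 := image_eq_zero_of_notMem_tsupport fun hm => b3 hm rfl
    rw [g2 b1 b2, hη0]
    simp
  · intro hc η b1 b2 _
    have : -1 * V₁ 0 - V 0 = 0 := by
      rw [hc] at hj
      push_cast at hj
      linear_combination -hj
    rw [g2 b1 b2, this]
    simp
  · have t1 := s.prim.hasTrace e
    have t2 := (s₁.prim.hasTrace (u := fun y => u (-y)) e₁).of_comp_neg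
    rw [← h0] at t2
    unfold HasTrace at t1 t2 ⊢
    rw [← nhdsLT_sup_nhdsGT, inf_sup_right]
    exact t2.sup t1
  · exact s.prim_deriv.hasTrace ev
  · exact HasTrace.of_comp_neg ((s₁.prim_deriv.const_mul (-1)).hasTrace ev₁')
  · linear_combination hj

theorem mem_deltaGraph_iff {q : ℝ → ℝ} (hq : ∀ y, q (-y) = q y) (hqm : Measurable q) {K : ℝ}
    (hqb : ∀ y, |q y| ≤ K) {c : ℝ} {u f : L2} :
    (u, f) ∈ deltaGraph q c ↔ IsGluedSolution q c u f := by
  refine ⟨isGluedSolution_of_mem_deltaGraph hq, fun h => ?_⟩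
  obtain ⟨v, w, a, r, l, h₁, h₂, -, h₄, h₅, h₆, h₇, h₈⟩ := h.exists_weakDeriv hq hqm hqb
  exact ⟨v, w, a, r, l, h₁, h₂, h₄, h₅, h₆, h₇, h₈⟩

theorem mem_regularGraph_iff {q : ℝ → ℝ} (hq : ∀ y, q (-y) = q y) (hqm : Measurable q) {K : ℝ}
    (hqb : ∀ y, |q y| ≤ K) {u f : L2} :
    (u, f) ∈ regularGraph q ↔ IsGluedSolution q 0 u f := by
  refine ⟨isGluedSolution_of_mem_regularGraph hq, fun h => ?_⟩
  obtain ⟨v, w, -, -, -, h₁, -, h₃, -, -, -, -, h₈⟩ := h.exists_weakDeriv hq hqm hqb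
  exact ⟨v, w, h₁, h₃ rfl, h₈⟩

/-! ### Parametrization of the graphs -/

namespace HalfLineBasis

variable {q : ℝ → ℝ} (B : HalfLineBasis q)

theorem memLp_even : MemLp (fun y => B.ψ |y|) 2 volume := by
  have m := (memLp_two_exp_neg_abs B.rate_pos 0).const_mul B.bound
  refine m.mono' (B.continuous_ψ.comp continuous_abs).aestronglyMeasurable
    (Eventually.of_forall fun y => ?_)
  rw [zero_sub, abs_neg]
  exact B.norm_ψ_le _ (abs_nonneg y)

/-- The even extension of the decaying solution. -/
def mode : L2 := B.memLp_even.toLp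

theorem coeFn_mode : B.mode =ᵐ[volume] fun y => B.ψ |y| := B.memLp_even.coeFn_toLp

/-- By `variation_deriv_zero` the two summands are the derivatives at 0+ of the Dirichlet solution
and of its reflection, so the inner product is its derivative jump. -/
theorem inner_mode (f : L2) : inner ℂ B.mode f =
    (∫ y in Ioi 0, B.ψ y * f y) + ∫ y in Ioi 0, B.ψ y * f (-y) := by
  have e : inner ℂ B.mode f = ∫ y, B.ψ |y| * f y := by
    rw [MeasureTheory.L2.inner_def]
    refine integral_congr_ae ?_
    filter_upwards [B.coeFn_mode] with y hy
    rw [RCLike.inner_apply, hy, B.conj_ψ, mul_comm]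
  have i : Integrable fun y => B.ψ |y| * f y := B.memLp_even.integrable_mul (Lp.memLp f)
  rw [e, ← integral_add_compl measurableSet_Ioi i]
  congr 1
  · refine setIntegral_congr_fun measurableSet_Ioi fun y hy => ?_
    rw [abs_of_pos hy]
  · rw [compl_Ioi, ← neg_zero, ← integral_comp_neg_Ioi, neg_zero]
    refine setIntegral_congr_fun measurableSet_Ioi fun y hy => ?_
    rw [abs_neg, abs_of_pos hy]

/-- By uniqueness, each half of `u` is the Dirichlet solution plus `s = u(0)` times `ψ`, which makes
continuity at 0 automatic. The scalar equation is the jump condition, to which the two copies of `ψ`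
contribute `2 * B.slope * s`. -/
theorem isGluedSolution_iff {c : ℝ} {u f : L2} : IsGluedSolution q c u f ↔
    ∃ s : ℂ, u = B.dirichlet f + s • B.mode ∧
      ((2 * B.slope + c : ℝ) : ℂ) * s = - inner ℂ B.mode f := by
  have mf := Lp.memLp f
  have mf₁ := memLp_comp_neg mf
  have S := (B.isHalfLineSolution_variation mf)
  have S₁ := (B.isHalfLineSolution_variation mf₁)
  have T (s : ℂ) : IsHalfLineSolution q (fun y => B.variation B.ψ B.θ f y + s * B.ψ y)
      (fun y => B.variation B.dψ B.dθ f y + s * B.dψ y) f := by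
    simpa using S.add (B.isHalfLineSolution_ψ.const_mul s)
  have T₁ (s : ℂ) : IsHalfLineSolution q
      (fun y => B.variation B.ψ B.θ (fun y => f (-y)) y + s * B.ψ y)
      (fun y => B.variation B.dψ B.dθ (fun y => f (-y)) y + s * B.dψ y) (fun y => f (-y)) := by
    simpa using S₁.add (B.isHalfLineSolution_ψ.const_mul s)
  have E (s : ℂ) : ∀ᵐ y, (B.dirichlet f + s • B.mode : L2) y =
      B.green B.ψ B.θ f y + s * B.ψ |y| := by
    filter_upwards [Lp.coeFn_add (B.dirichlet f) (s • B.mode), Lp.coeFn_smul s B.mode,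
      B.coeFn_dirichlet f, B.coeFn_mode] with y e1 e2 e3 e4
    rw [e1, Pi.add_apply, e2, Pi.smul_apply, e3, e4, smul_eq_mul]
  have G (y : ℝ) (hy : 0 < y) : B.green B.ψ B.θ f y = B.variation B.ψ B.θ f y :=
    green_eq_variation B.isAdmissible_basis mf hy
  have G₁ (y : ℝ) (hy : 0 < y) : B.green B.ψ B.θ f (-y) =
      B.variation B.ψ B.θ (fun y => f (-y)) y := by
    rw [green_neg, green_eq_variation B.isAdmissible_basis mf₁ hy]
  constructor
  · rintro ⟨U, V, U₁, V₁, s, s₁, e, e₁, h0, hj⟩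
    have k (y : ℝ) (hy : 0 ≤ y) := B.isHalfLineSolution_unique s (T (U 0))
      (by simp [variation_zero, B.ψ_zero]) hy
    have k₁ (y : ℝ) (hy : 0 ≤ y) := B.isHalfLineSolution_unique s₁ (T₁ (U 0))
      (by simp [variation_zero, B.ψ_zero, h0]) hy
    refine ⟨U 0, ?_, ?_⟩
    · apply Lp.ext
      refine ae_of_pos_of_neg ?_ ?_
      · filter_upwards [e, E (U 0)] with y a1 a2 hy
        rw [a1 hy, a2, G y hy, abs_of_pos hy, (k y hy.le).1]
      · filter_upwards [e₁, ae_neg (E (U 0))] with y a1 a2 hy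
        rw [a1 hy, a2, G₁ y hy, abs_neg, abs_of_pos hy, (k₁ y hy.le).1]
    · have v := (k 0 le_rfl).2
      have v₁ := (k₁ 0 le_rfl).2
      rw [variation_deriv_zero, B.dψ_zero] at v v₁
      rw [inner_mode]
      push_cast
      linear_combination hj - v - v₁
  · rintro ⟨s, rfl, hs⟩
    refine ⟨_, _, _, _, T s, T₁ s, ?_, ?_, ?_, ?_⟩
    · filter_upwards [E s] with y a2 hy
      rw [a2, G y hy, abs_of_pos hy]
    · filter_upwards [ae_neg (E s)] with y a2 hy
      rw [a2, G₁ y hy, abs_neg, abs_of_pos hy]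
    · simp [variation_zero]
    · simp only [variation_deriv_zero, variation_zero, B.dψ_zero, B.ψ_zero]
      rw [inner_mode] at hs
      push_cast at hs
      linear_combination hs

end HalfLineBasis

/-! ### Resolvents of operators given by a rank one boundary condition -/

theorem mem_resolvent_of_inverse {L : L2 →ₗ.[ℂ] L2} {μ : ℂ} (T : L2 →L[ℂ] L2)
    (h₁ : ∀ u f, (u, f) ∈ L.graph → T (μ • u - f) = u)
    (h₂ : ∀ h, (T h, μ • T h - h) ∈ L.graph) : μ ∈ resolvent L := by
  have left (x : L.domain) : T (μ • (x : L2) - L x) = x := h₁ _ _ (L.mem_graph x)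
  refine ⟨⟨fun x y hxy => ?_, fun h => ?_⟩, ‖T‖, fun x => ?_⟩
  · have e := congrArg T hxy
    simp only [left] at e
    exact Subtype.ext e
  · obtain ⟨x, hx, hx'⟩ := L.mem_graph_iff.1 (h₂ h)
    refine ⟨x, ?_⟩
    simp only at hx hx' ⊢
    rw [hx', hx, sub_sub_cancel]
  · conv_lhs => rw [← left x]
    exact T.le_opNorm _

/-- The scalar equation can be solved for `s`, and the inverse of `-L` is `-R` plus a rank one term
along `g`. -/
theorem zero_mem_resolvent_of_graph {L : L2 →ₗ.[ℂ] L2} {R : L2 →L[ℂ] L2} {g : L2} {κ : ℂ}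
    (hκ : κ ≠ 0)
    (hL : ∀ u f, (u, f) ∈ L.graph ↔ ∃ s : ℂ, u = R f + s • g ∧ κ * s = - inner ℂ g f) :
    (0 : ℂ) ∈ resolvent L := by
  refine mem_resolvent_of_inverse (-R + κ⁻¹ • (innerSL ℂ g).smulRight g) ?_ ?_
  · intro u f h
    obtain ⟨s, rfl, hs⟩ := (hL u f).1 h
    have : κ⁻¹ * inner ℂ g f = -s := by
      rw [← neg_eq_iff_eq_neg.2 hs]
      field_simp
    simp [smul_smul, this]
  · intro h
    rw [hL]
    refine ⟨κ⁻¹ * inner ℂ g h, ?_, ?_⟩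
    · simp [smul_smul]
    · rw [zero_smul, zero_sub, inner_neg_right]
      field_simp

theorem kernel_eq_span_of_graph {L : L2 →ₗ.[ℂ] L2} {R : L2 →L[ℂ] L2} {g : L2}
    (hL : ∀ u f, (u, f) ∈ L.graph ↔ ∃ s : ℂ, u = R f + s • g ∧ 0 = inner ℂ g f) :
    kernel L = Submodule.span ℂ {g} := by
  have key (u : L2) : u ∈ kernel L ↔ (u, (0 : L2)) ∈ L.graph := by
    rw [LinearPMap.mem_graph_iff]
    constructor
    · rintro ⟨x, hx, rfl⟩
      exact ⟨x, rfl, hx⟩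
    · rintro ⟨x, rfl, hx⟩
      exact ⟨x, hx, rfl⟩
  ext u
  rw [key, hL, Submodule.mem_span_singleton]
  constructor
  · rintro ⟨s, hs, -⟩
    exact ⟨s, by simpa using hs.symm⟩
  · rintro ⟨s, hs⟩
    exact ⟨s, by simpa using hs.symm, by simp⟩

/-- For small μ the operator 1 - μR has an inverse S, and d(μ) = ⟨g, S g⟩ stays near ‖g‖² ≠ 0.
Solving μu - Lu = h gives u = s S g - S R h, and the constraint ⟨g, μu - h⟩ = 0 fixes s after
division by μd, which is nonzero exactly when μ ≠ 0 in this range. -/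
theorem zeroIsIsolatedSimpleEigenvalue_of_graph {L : L2 →ₗ.[ℂ] L2} {R : L2 →L[ℂ] L2} {g : L2}
    (hg : g ≠ 0)
    (hL : ∀ u f, (u, f) ∈ L.graph ↔ ∃ s : ℂ, u = R f + s • g ∧ 0 = inner ℂ g f) :
    ZeroIsIsolatedSimpleEigenvalue L := by
  refine ⟨by rw [kernel_eq_span_of_graph hL, finrank_span_singleton hg], ?_⟩
  have hc : ContinuousAt (fun μ : ℂ => (1 : L2 →L[ℂ] L2) - μ • R) 0 := by fun_prop
  have h1 : (1 : L2 →L[ℂ] L2) - (0 : ℂ) • R = ((1 : (L2 →L[ℂ] L2)ˣ) : L2 →L[ℂ] L2) := by simp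
  have hunit : ∀ᶠ μ : ℂ in 𝓝 0, IsUnit ((1 : L2 →L[ℂ] L2) - μ • R) :=
    hc.eventually (Units.isOpen.mem_nhds (by
      change IsUnit ((1 : L2 →L[ℂ] L2) - (0 : ℂ) • R)
      rw [h1]
      exact (1 : (L2 →L[ℂ] L2)ˣ).isUnit))
  have hinv : ContinuousAt (fun μ : ℂ => Ring.inverse ((1 : L2 →L[ℂ] L2) - μ • R)) 0 := by
    refine ContinuousAt.comp (g := Ring.inverse) ?_ hc
    rw [h1]
    exact NormedRing.inverse_continuousAt 1
  have hd : ContinuousAt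
      (fun μ : ℂ => inner ℂ g (Ring.inverse ((1 : L2 →L[ℂ] L2) - μ • R) g)) 0 :=
    continuousAt_const.inner (hinv.clm_apply continuousAt_const)
  have hne : ∀ᶠ μ : ℂ in 𝓝 0, inner ℂ g (Ring.inverse ((1 : L2 →L[ℂ] L2) - μ • R) g) ≠ 0 := by
    refine hd.eventually_ne ?_
    rw [h1, Ring.inverse_unit]
    simpa using hg
  obtain ⟨ε, hε, hball⟩ := Metric.eventually_nhds_iff.1 (hunit.and hne)
  refine ⟨ε, hε, fun μ hμ0 hμ => ?_⟩
  have hμne : μ ≠ 0 := norm_pos_iff.1 hμ0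
  obtain ⟨hu, hdne⟩ := hball (y := μ) (by simpa using hμ)
  set S := Ring.inverse ((1 : L2 →L[ℂ] L2) - μ • R) with hS
  have SN (x : L2) : S (x - μ • R x) = x := by
    have := congrArg (fun A : L2 →L[ℂ] L2 => A x) (Ring.inverse_mul_cancel _ hu)
    simpa using this
  have NS (x : L2) : S x - μ • R (S x) = x := by
    have := congrArg (fun A : L2 →L[ℂ] L2 => A x) (Ring.mul_inverse_cancel _ hu)
    simpa using this
  set d : ℂ := inner ℂ g (S g) with hddef
  -- The coefficient of `S g` in the solution, obtained from the orthogonality constraint.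
  let σ : L2 →L[ℂ] ℂ := (μ * d)⁻¹ • (innerSL ℂ g + μ • (innerSL ℂ g).comp (S.comp R))
  have hσ (h : L2) : σ h = (μ * d)⁻¹ * (inner ℂ g h + μ * inner ℂ g (S (R h))) := by
    simp [σ]
    ring
  refine mem_resolvent_of_inverse (σ.smulRight (S g) - S.comp R) ?_ ?_
  · intro u f hf
    obtain ⟨s, hs, h0⟩ := (hL u f).1 hf
    have e : u = s • S g - S (R (μ • u - f)) := by
      have k : u - μ • R u = s • g - R (μ • u - f) := by
        rw [map_sub, map_smul, ← sub_eq_zero, ← sub_eq_zero.2 hs]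
        abel
      have := congrArg S k
      rwa [SN, map_sub, map_smul] at this
    have e' : inner ℂ g u = s * d - inner ℂ g (S (R (μ • u - f))) := by
      conv_lhs => rw [e]
      rw [inner_sub_right, inner_smul_right]
    have hs' : σ (μ • u - f) = s := by
      rw [hσ, inner_sub_right, ← h0, inner_smul_right, e']
      field_simp
      ring
    simp only [sub_apply, ContinuousLinearMap.smulRight_apply, hs',
      ContinuousLinearMap.comp_apply]
    exact e.symm
  · intro h
    rw [hL]
    set u := (σ.smulRight (S g) - S.comp R) h with hudef
    have hu' : u = σ h • S g - S (R h) := by simp [hudef]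
    refine ⟨σ h, ?_, ?_⟩
    · have e : u - μ • R u = σ h • g - R h := by
        have a := NS g
        have b := NS (R h)
        rw [hu', map_sub, map_smul]
        calc _ = σ h • (S g - μ • R (S g)) - (S (R h) - μ • R (S (R h))) := by module
          _ = _ := by rw [a, b]
      rw [map_sub, map_smul, ← sub_eq_zero]
      rw [← sub_eq_zero] at e
      rw [← e]
      abel
    · rw [inner_sub_right, inner_smul_right, hu', inner_sub_right, inner_smul_right, hσ, ← hddef]
      field_simp
      ring

/-! ### Resolvent and kernel of the concrete operators. -/

namespace HalfLineBasis

variable {q : ℝ → ℝ} (B : HalfLineBasis q)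

theorem mem_graph_deltaOp_iff (hq : ∀ y, q (-y) = q y) (hqm : Measurable q) {K : ℝ}
    (hqb : ∀ y, |q y| ≤ K) (c : ℝ) (u f : L2) : (u, f) ∈ (deltaOp q c).graph ↔
      ∃ s : ℂ, u = B.dirichlet f + s • B.mode ∧
        ((2 * B.slope + c : ℝ) : ℂ) * s = - inner ℂ B.mode f := by
  rw [deltaOp_graph, mem_deltaGraph_iff hq hqm hqb, B.isGluedSolution_iff]

theorem zero_mem_resolvent_deltaOp (hq : ∀ y, q (-y) = q y) (hqm : Measurable q) {K : ℝ}
    (hqb : ∀ y, |q y| ≤ K) {c : ℝ} (hc : 2 * B.slope + c ≠ 0) :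
    (0 : ℂ) ∈ resolvent (deltaOp q c) :=
  zero_mem_resolvent_of_graph (Complex.ofReal_ne_zero.2 hc)
    (B.mem_graph_deltaOp_iff hq hqm hqb c)

theorem zero_mem_resolvent_regularOp (hq : ∀ y, q (-y) = q y) (hqm : Measurable q) {K : ℝ}
    (hqb : ∀ y, |q y| ≤ K) (hc : B.slope ≠ 0) : (0 : ℂ) ∈ resolvent (regularOp q) := by
  refine zero_mem_resolvent_of_graph (κ := ((2 * B.slope + 0 : ℝ) : ℂ)) (R := B.dirichlet)
    (g := B.mode) (Complex.ofReal_ne_zero.2 (by simpa using hc)) fun u f => ?_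
  rw [regularOp_graph, mem_regularGraph_iff hq hqm hqb, B.isGluedSolution_iff]

theorem mem_graph_deltaOp_iff_of_critical (hq : ∀ y, q (-y) = q y) (hqm : Measurable q) {K : ℝ}
    (hqb : ∀ y, |q y| ≤ K) {c : ℝ} (hc : 2 * B.slope + c = 0) (u f : L2) :
    (u, f) ∈ (deltaOp q c).graph ↔
      ∃ s : ℂ, u = B.dirichlet f + s • B.mode ∧ 0 = inner ℂ B.mode f := by
  rw [B.mem_graph_deltaOp_iff hq hqm hqb, hc]
  simp only [Complex.ofReal_zero, zero_mul, zero_eq_neg, eq_comm]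

theorem mode_ne_zero : B.mode ≠ 0 := by
  intro h
  have e : ∀ᵐ y, B.ψ |y| = 0 := by
    filter_upwards [B.coeFn_mode, Lp.coeFn_zero ℂ 2 (volume : Measure ℝ)] with y h1 h2
    rw [← h1, h, h2, Pi.zero_apply]
  have c : Continuous fun y : ℝ => B.ψ |y| := B.continuous_ψ.comp continuous_abs
  have := congrFun ((c.ae_eq_iff_eq volume continuous_const).1 e) 0
  simp [B.ψ_zero] at this

theorem kernel_deltaOp (hq : ∀ y, q (-y) = q y) (hqm : Measurable q) {K : ℝ}
    (hqb : ∀ y, |q y| ≤ K) {c : ℝ} (hc : 2 * B.slope + c = 0) :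
    kernel (deltaOp q c) = Submodule.span ℂ {B.mode} :=
  kernel_eq_span_of_graph (B.mem_graph_deltaOp_iff_of_critical hq hqm hqb hc)

theorem zeroIsIsolatedSimpleEigenvalue_deltaOp (hq : ∀ y, q (-y) = q y) (hqm : Measurable q)
    {K : ℝ} (hqb : ∀ y, |q y| ≤ K) {c : ℝ} (hc : 2 * B.slope + c = 0) :
    ZeroIsIsolatedSimpleEigenvalue (deltaOp q c) :=
  zeroIsIsolatedSimpleEigenvalue_of_graph B.mode_ne_zero
    (B.mem_graph_deltaOp_iff_of_critical hq hqm hqb hc)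

/-! ### Decaying modes -/

theorem isDecayingMode_ψ (hqm : Measurable q) {K : ℝ} (hqb : ∀ y, |q y| ≤ K) :
    IsDecayingMode q B.ψ := by
  have s := B.isHalfLineSolution_ψ
  have hw : MemLp (fun y => (q y : ℂ) * B.ψ y) 2 (volume.restrict (Ioi 0)) := by
    refine (s.memLp.const_mul (K : ℂ)).mono
      ((Complex.measurable_ofReal.comp hqm).aestronglyMeasurable.mul s.memLp.1)
      (Eventually.of_forall fun y => ?_)
    rw [norm_mul, norm_mul, Complex.norm_real, Complex.norm_real, Real.norm_eq_abs,
      Real.norm_eq_abs]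
    exact mul_le_mul_of_nonneg_right ((hqb y).trans (le_abs_self K)) (norm_nonneg _)
  have weak {u v : ℝ → ℂ} (h : IsPrimitiveOn u v (Ici 0)) : IsWeakDeriv (Ioi 0) u v := by
    intro η h1 h2 h3
    have h0 : η 0 = 0 := image_eq_zero_of_notMem_tsupport fun hm => lt_irrefl (0 : ℝ) (h3 hm)
    rw [integral_eq_setIntegral_Ioi_of_tsupport (tsupport_deriv_subset.trans h3),
      integral_eq_setIntegral_Ioi_of_tsupport h3, h.integral_deriv_smul h1 h2, h0]
    simp
  refine ⟨s.memLp, ⟨B.dψ, _, s.memLp_deriv, hw, weak B.prim_ψ, weak B.prim_dψ,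
    Eventually.of_forall fun y _ => by ring⟩, ?_⟩
  rw [← B.ψ_zero]
  exact B.prim_ψ.hasTrace (Eventually.of_forall fun y _ => rfl)

/-- Reduces the bound required of every decaying mode to a bound for the explicit `ψ`. -/
theorem ae_eq_ψ_of_isDecayingMode {φ : ℝ → ℂ} (h : IsDecayingMode q φ) :
    φ =ᵐ[volume.restrict (Ioi 0)] B.ψ := by
  obtain ⟨mφ, ⟨v, w, mv, mw, h₁, h₂, he⟩, ht⟩ := h
  obtain ⟨U, V, s, e, -⟩ := exists_isHalfLineSolution (q := q) (f := 0) mφ mv mw h₁ h₂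
    (he.mono fun y hy h0 => (hy h0).symm)
  have h0 : U 0 = 1 := tendsto_nhds_unique (s.prim.hasTrace e) ht
  rw [EventuallyEq, ae_restrict_iff' measurableSet_Ioi]
  filter_upwards [e] with y hy hy0
  rw [hy hy0]
  exact (B.isHalfLineSolution_unique s B.isHalfLineSolution_ψ (h0.trans B.ψ_zero.symm)
    (le_of_lt hy0)).1

end HalfLineBasis

/-! ### Fundamental systems for step coefficients -/

/-- The function equal to `f` up to `b` and to `g` beyond `b`. -/
def glue (b : ℝ) (f g : ℝ → ℝ) (y : ℝ) : ℝ := if y ≤ b then f y else g y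

theorem continuous_glue {b : ℝ} {f g : ℝ → ℝ} (hf : Continuous f) (hg : Continuous g)
    (h : f b = g b) : Continuous (glue b f g) :=
  hf.if_le hg continuous_id continuous_const fun y hy => by
    have hy' : y = b := hy
    rw [hy', h]

theorem locallyIntegrable_glue {b : ℝ} {f g : ℝ → ℝ} (hf : Continuous f) (hg : Continuous g) :
    LocallyIntegrable fun y => ((glue b f g y : ℝ) : ℂ) := by
  have h₁ := (Complex.continuous_ofReal.comp hf).locallyIntegrable (μ := volume).indicator
    (measurableSet_Iic (a := b))
  have h₂ := (Complex.continuous_ofReal.comp hg).locallyIntegrable (μ := volume).indicator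
    (measurableSet_Iic (a := b)).compl
  have e : (fun y => ((glue b f g y : ℝ) : ℂ)) =
      (Iic b).indicator (Complex.ofReal ∘ f) + (Iic b)ᶜ.indicator (Complex.ofReal ∘ g) := by
    ext y
    by_cases hy : y ≤ b
    · simp [glue, hy]
    · simp [glue, hy, not_le.1 hy]
  rw [e]
  exact h₁.add h₂

theorem isPrimitiveOn_glue {b : ℝ} {f g f' g' : ℝ → ℝ} (hf : ∀ y, HasDerivAt f (f' y) y)
    (hg : ∀ y, HasDerivAt g (g' y) y) (cf : Continuous f') (cg : Continuous g') (h : f b = g b) :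
    IsPrimitiveOn (fun y => ((glue b f g y : ℝ) : ℂ)) (fun y => ((glue b f' g' y : ℝ) : ℂ))
      (Ici 0) := by
  have hcf : Continuous f := continuous_iff_continuousAt.2 fun y => (hf y).continuousAt
  have hcg : Continuous g := continuous_iff_continuousAt.2 fun y => (hg y).continuousAt
  refine isPrimitiveOn_of_hasDerivAt ordConnected_Ici (countable_singleton b)
    (Complex.continuous_ofReal.comp (continuous_glue hcf hcg h)) (fun y _ hy => ?_)
    fun a _ c _ => (locallyIntegrable_glue cf cg).intervalIntegrable a c
  refine HasDerivAt.ofReal_comp ?_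
  rcases lt_or_gt_of_ne (show y ≠ b from hy) with hlt | hlt
  · have : glue b f' g' y = f' y := if_pos hlt.le
    rw [this]
    refine (hf y).congr_of_eventuallyEq ?_
    filter_upwards [eventually_lt_nhds hlt] with x hx
    exact if_pos hx.le
  · have : glue b f' g' y = g' y := if_neg (not_le.2 hlt)
    rw [this]
    refine (hg y).congr_of_eventuallyEq ?_
    filter_upwards [eventually_gt_nhds hlt] with x hx
    exact if_neg (not_le.2 hx)

/-- On the compact interval [0,b] continuity suffices, so only the exponential tail has to be
estimated. -/
theorem exists_exp_bound {f : ℝ → ℝ} (hf : Continuous f) {b r K : ℝ}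
    (h : ∀ y, b < y → |f y| ≤ K * Real.exp (r * y)) :
    ∃ M, ∀ y, 0 ≤ y → |f y| ≤ M * Real.exp (r * y) := by
  obtain ⟨M, hM⟩ := isCompact_Icc.exists_bound_of_continuousOn (s := Icc 0 b)
    (f := fun y => f y * Real.exp (-(r * y))) (by fun_prop)
  refine ⟨max M K, fun y hy => ?_⟩
  have he := Real.exp_pos (r * y)
  by_cases hyb : y ≤ b
  · have k := hM y ⟨hy, hyb⟩
    rw [Real.norm_eq_abs, abs_mul, abs_of_pos (Real.exp_pos _), Real.exp_neg] at k
    rw [← div_eq_mul_inv, div_le_iff₀ he] at k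
    exact k.trans (mul_le_mul_of_nonneg_right (le_max_left _ _) he.le)
  · exact (h y (not_le.1 hyb)).trans (mul_le_mul_of_nonneg_right (le_max_right _ _) he.le)

/-- The coefficient with value `m` on `(-b,b)` and `μ²` outside. -/
def stepCoeff (b m μ : ℝ) (y : ℝ) : ℝ := if b ≤ |y| then μ ^ 2 else m

theorem isPrimitiveOn_glue_step {b m μ : ℝ} {f g f' g' : ℝ → ℝ} (cf : Continuous f)
    (cg : Continuous g) (hf : ∀ y, HasDerivAt f' (m * f y) y)
    (hg : ∀ y, HasDerivAt g' (μ ^ 2 * g y) y) (h : f' b = g' b) :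
    IsPrimitiveOn (fun y => ((glue b f' g' y : ℝ) : ℂ))
      (fun y => (stepCoeff b m μ y : ℂ) * ((glue b f g y : ℝ) : ℂ)) (Ici 0) := by
  refine (isPrimitiveOn_glue (f' := fun y => m * f y) (g' := fun y => μ ^ 2 * g y) hf hg
    (by fun_prop) (by fun_prop) h).congr_deriv ordConnected_Ici ?_
  -- At `y = b` itself `glue` takes the inner branch and `stepCoeff` the outer one; this null set is
  -- discarded.
  filter_upwards [volume.ae_ne b] with y hy hy0
  rw [← Complex.ofReal_mul]
  congr 1
  unfold glue stepCoeff
  rw [abs_of_nonneg hy0]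
  rcases lt_or_gt_of_ne hy with hlt | hlt
  · rw [if_pos hlt.le, if_pos hlt.le, if_neg (not_le.2 hlt)]
  · rw [if_neg (not_le.2 hlt), if_neg (not_le.2 hlt), if_pos hlt.le]

/-- The fundamental system of a step coefficient, built from the solutions `C`, `S` of
`u'' = m u` with initial values `(1, 0)` and `(0, 1)`. -/
theorem exists_stepBasis {b m μ : ℝ} (hb : 0 < b) (hμ : 0 < μ) {C S : ℝ → ℝ}
    (hC : ∀ y, HasDerivAt C (m * S y) y) (hS : ∀ y, HasDerivAt S (C y) y) (hC0 : C 0 = 1)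
    (hS0 : S 0 = 0) (hW : C b ^ 2 - m * S b ^ 2 = 1) (hN : C b + μ * S b ≠ 0) {D : ℝ}
    (hD : D = -((m * S b + μ * C b) / (C b + μ * S b))) :
    ∃ B : HalfLineBasis (stepCoeff b m μ), B.slope = D ∧ B.ψ b ≠ 0 ∧
      (∀ y, y ≤ b → B.ψ y = ((C y + D * S y : ℝ) : ℂ)) ∧
      ∀ y, b ≤ y → B.ψ y = (((C b + D * S b) * Real.exp (-μ * (y - b)) : ℝ) : ℂ) := by
  have cC : Continuous C := continuous_iff_continuousAt.2 fun y => (hC y).continuousAt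
  have cS : Continuous S := continuous_iff_continuousAt.2 fun y => (hS y).continuousAt
  set N := C b + μ * S b with hNdef
  -- The slope `D` is chosen so that C + DS has logarithmic derivative -μ at `b`, matching the
  -- decaying exponential. By `hW` the common value at `b` is `N⁻¹`.
  have hDN : D * N = -(m * S b + μ * C b) := by rw [hD]; field_simp
  have hψb : C b + D * S b = N⁻¹ := by
    refine eq_inv_of_mul_eq_one_left ?_
    linear_combination (S b) * hDN + hW + C b * hNdef
  have hdψb : m * S b + D * C b = -μ * N⁻¹ := by
    rw [← div_eq_mul_inv, eq_div_iff hN]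
    linear_combination (C b) * hDN + (-μ) * hW + (m * S b) * hNdef
  have de (r : ℝ) (y : ℝ) : HasDerivAt (fun y => Real.exp (r * (y - b)))
      (r * Real.exp (r * (y - b))) y := by
    have := (((hasDerivAt_id y).sub_const b).const_mul r).exp
    simpa [mul_comm] using this
  set E : ℝ → ℝ := fun y => Real.exp (-μ * (y - b)) with hE
  set F : ℝ → ℝ := fun y => Real.exp (μ * (y - b)) with hF
  have cE : Continuous E := by fun_prop
  have cF : Continuous F := by fun_prop
  have Eb : E b = 1 := by simp [hE]
  have Fb : F b = 1 := by simp [hF]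
  have dE (y : ℝ) : HasDerivAt E (-μ * E y) y := de (-μ) y
  have dF (y : ℝ) : HasDerivAt F (μ * F y) y := de μ y
  -- Coefficients of the growing and decaying exponentials that continue `S` past `b` with matching
  -- value and derivative.
  set A₁ : ℝ := (S b + C b / μ) / 2 with hA₁
  set A₂ : ℝ := (S b - C b / μ) / 2 with hA₂
  have hθb : S b = A₁ * F b + A₂ * E b := by rw [Eb, Fb]; ring
  have hdθb : C b = μ * (A₁ * F b - A₂ * E b) := by
    rw [Eb, Fb, hA₁, hA₂]; field_simp; ring
  set ψ := glue b (fun y => C y + D * S y) (fun y => N⁻¹ * E y) with hψ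
  set dψ := glue b (fun y => m * S y + D * C y) (fun y => -μ * N⁻¹ * E y) with hdψ
  set θ := glue b S (fun y => A₁ * F y + A₂ * E y) with hθ
  set dθ := glue b C (fun y => μ * (A₁ * F y - A₂ * E y)) with hdθ
  have hψb' : C b + D * S b = N⁻¹ * E b := by rw [Eb, mul_one, hψb]
  have hdψb' : m * S b + D * C b = -μ * N⁻¹ * E b := by rw [Eb, mul_one, hdψb]
  have cψ : Continuous ψ := continuous_glue (by fun_prop) (by fun_prop) hψb'
  have cdψ : Continuous dψ := continuous_glue (by fun_prop) (by fun_prop) hdψb'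
  have cθ : Continuous θ := continuous_glue (by fun_prop) (by fun_prop) hθb
  have cdθ : Continuous dθ := continuous_glue (by fun_prop) (by fun_prop) hdθb
  have out (f g : ℝ → ℝ) {y : ℝ} (hy : b < y) : glue b f g y = g y := if_neg (not_le.2 hy)
  have inn (f g : ℝ → ℝ) : glue b f g 0 = f 0 := if_pos hb.le
  have hEe (y : ℝ) : E y = Real.exp (μ * b) * Real.exp (-μ * y) := by
    rw [hE, ← Real.exp_add]; simp only; ring_nf
  have hEpos (y : ℝ) : 0 < E y := Real.exp_pos _
  have hFpos (y : ℝ) : 0 < F y := Real.exp_pos _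
  have hFle (y : ℝ) : F y ≤ Real.exp (μ * y) := Real.exp_le_exp.2 (by nlinarith)
  have hEle {y : ℝ} (hy : b < y) : E y ≤ Real.exp (μ * y) := Real.exp_le_exp.2 (by nlinarith)
  obtain ⟨M₁, hM₁⟩ := exists_exp_bound cψ (b := b) (r := -μ) (K := |N⁻¹| * Real.exp (μ * b))
    fun y hy => by
      rw [hψ, out _ _ hy, abs_mul, abs_of_pos (hEpos y), hEe, mul_assoc]
  obtain ⟨M₂, hM₂⟩ := exists_exp_bound cdψ (b := b) (r := -μ)
    (K := |-μ * N⁻¹| * Real.exp (μ * b)) fun y hy => by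
      rw [hdψ, out _ _ hy, abs_mul, abs_of_pos (hEpos y), hEe, mul_assoc]
  have comb {y : ℝ} (hy : b < y) (s : ℝ) (hs : |s| = 1) :
      |A₁ * F y + s * (A₂ * E y)| ≤ (|A₁| + |A₂|) * Real.exp (μ * y) := by
    refine (abs_add_le _ _).trans ?_
    rw [abs_mul s, hs, one_mul, abs_mul, abs_mul, abs_of_pos (hEpos y), abs_of_pos (hFpos y),
      add_mul]
    exact add_le_add (mul_le_mul_of_nonneg_left (hFle y) (abs_nonneg _))
      (mul_le_mul_of_nonneg_left (hEle hy) (abs_nonneg _))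
  obtain ⟨M₃, hM₃⟩ := exists_exp_bound cθ (b := b) (r := μ) (K := |A₁| + |A₂|)
    fun y hy => by
      rw [hθ, out _ _ hy]
      simpa using comb hy 1 (by simp)
  obtain ⟨M₄, hM₄⟩ := exists_exp_bound cdθ (b := b) (r := μ) (K := μ * (|A₁| + |A₂|))
    fun y hy => by
      rw [hdθ, out _ _ hy, abs_mul, abs_of_pos hμ, mul_assoc]
      refine mul_le_mul_of_nonneg_left ?_ hμ.le
      simpa [sub_eq_add_neg] using comb hy (-1) (by simp)
  set M := max (max M₁ M₂) (max M₃ M₄) with hM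
  have lift {f : ℝ → ℝ} {K r : ℝ} (hK : K ≤ M) (h : ∀ y, 0 ≤ y → |f y| ≤ K * Real.exp (r * y))
      (y : ℝ) (hy : 0 ≤ y) : ‖((f y : ℝ) : ℂ)‖ ≤ M * Real.exp (r * y) := by
    rw [Complex.norm_real, Real.norm_eq_abs]
    exact (h y hy).trans (mul_le_mul_of_nonneg_right hK (Real.exp_pos _).le)
  refine ⟨{
    ψ := fun y => ((ψ y : ℝ) : ℂ)
    dψ := fun y => ((dψ y : ℝ) : ℂ)
    θ := fun y => ((θ y : ℝ) : ℂ)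
    dθ := fun y => ((dθ y : ℝ) : ℂ)
    slope := D
    rate := μ
    bound := M
    rate_pos := hμ
    continuous_ψ := Complex.continuous_ofReal.comp cψ
    continuous_dψ := Complex.continuous_ofReal.comp cdψ
    continuous_θ := Complex.continuous_ofReal.comp cθ
    continuous_dθ := Complex.continuous_ofReal.comp cdθ
    prim_ψ := isPrimitiveOn_glue (fun y => (hC y).add ((hS y).const_mul D))
      (fun y => ((dE y).const_mul N⁻¹).congr_deriv (by ring))
      (by fun_prop) (by fun_prop) hψb'
    prim_dψ := isPrimitiveOn_glue_step (by fun_prop) (by fun_prop)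
      (fun y => (((hS y).const_mul m).add ((hC y).const_mul D)).congr_deriv (by ring))
      (fun y => ((dE y).const_mul (-μ * N⁻¹)).congr_deriv (by ring)) hdψb'
    prim_θ := isPrimitiveOn_glue hS
      (fun y => (((dF y).const_mul A₁).add ((dE y).const_mul A₂)).congr_deriv (by ring))
      cC (by fun_prop) hθb
    prim_dθ := isPrimitiveOn_glue_step cS (by fun_prop) hC
      (fun y => ((((dF y).const_mul A₁).sub ((dE y).const_mul A₂)).const_mul μ).congr_deriv
        (by ring)) hdθb
    ψ_zero := by rw [hψ, inn, hC0, hS0]; simp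
    dψ_zero := by rw [hdψ, inn, hC0, hS0]; simp
    θ_zero := by rw [hθ, inn, hS0]; simp
    dθ_zero := by rw [hdθ, inn, hC0]; simp
    conj_ψ := fun y => Complex.conj_ofReal _
    norm_ψ_le := lift ((le_max_left _ _).trans (le_max_left _ _)) hM₁
    norm_dψ_le := lift ((le_max_right _ _).trans (le_max_left _ _)) hM₂
    norm_θ_le := lift ((le_max_left _ _).trans (le_max_right _ _)) hM₃
    norm_dθ_le := lift ((le_max_right _ _).trans (le_max_right _ _)) hM₄ }, rfl, ?_, fun y hy => ?_, fun y hy => ?_⟩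
  · have : ψ b = N⁻¹ := (if_pos le_rfl).trans hψb
    simp only [this]
    exact Complex.ofReal_ne_zero.2 (inv_ne_zero hN)
  · exact congrArg Complex.ofReal (if_pos hy)
  · rw [hψb]
    refine congrArg Complex.ofReal ?_
    rcases hy.eq_or_lt with rfl | hlt
    · exact (if_pos le_rfl).trans hψb'
    · exact out _ _ hlt

/-! ### Transversality and uniform bounds -/

namespace HalfLineBasis

variable {q : ℝ → ℝ} (B : HalfLineBasis q)

/-- The integrand is nonnegative, so a zero integral would make it vanish almost everywhere; but `φ`
is a nonzero multiple of the mode, which by continuity does not vanish just to the right of `b`. -/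
theorem integral_indicator_mul_norm_sq_ne_zero {b : ℝ} (hb : 0 < b) (hψ : B.ψ b ≠ 0) {φ : L2}
    (h : Submodule.span ℂ {B.mode} = Submodule.span ℂ {φ}) :
    ∫ y, ({y : ℝ | b ≤ |y|}.indicator 1 y : ℝ) * ‖φ y‖ ^ 2 ≠ 0 := by
  obtain ⟨s, hs⟩ := Submodule.mem_span_singleton.1
    (h ▸ Submodule.mem_span_singleton_self φ : φ ∈ Submodule.span ℂ {B.mode})
  have hs0 : s ≠ 0 := by
    rintro rfl
    rw [zero_smul] at hs
    rw [← hs, Submodule.span_singleton_eq_bot.2 rfl, Submodule.span_singleton_eq_bot] at h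
    exact B.mode_ne_zero h
  have hφ : ∀ᵐ y, φ y = s * B.ψ |y| := by
    filter_upwards [Lp.coeFn_smul s B.mode, B.coeFn_mode] with y e1 e2
    rw [← hs, e1, Pi.smul_apply, e2, smul_eq_mul]
  have hmeas : MeasurableSet {y : ℝ | b ≤ |y|} := measurableSet_le (by fun_prop) (by fun_prop)
  have hrw (y : ℝ) : ({y : ℝ | b ≤ |y|}.indicator 1 y : ℝ) * ‖φ y‖ ^ 2 =
      {y : ℝ | b ≤ |y|}.indicator (fun y => ‖φ y‖ ^ 2) y := by
    by_cases hy : y ∈ {y : ℝ | b ≤ |y|}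
    · rw [indicator_of_mem hy, indicator_of_mem hy, Pi.one_apply, one_mul]
    · rw [indicator_of_notMem hy, indicator_of_notMem hy, zero_mul]
  simp only [hrw]
  have i : Integrable ({y : ℝ | b ≤ |y|}.indicator fun y => ‖φ y‖ ^ 2) :=
    ((Lp.memLp φ).integrable_norm_pow (by norm_num)).indicator hmeas
  intro h0
  have hz := (integral_eq_zero_iff_of_nonneg
    (fun y => indicator_nonneg (fun y _ => sq_nonneg _) y) i).1 h0
  have hnhds : ∀ᶠ y in 𝓝 b, B.ψ y ≠ 0 := B.continuous_ψ.continuousAt.eventually_ne hψ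
  obtain ⟨ε, hε, hball⟩ := Metric.eventually_nhds_iff.1 hnhds
  have hsub : Ioo b (b + ε) ⊆
      {y | {y : ℝ | b ≤ |y|}.indicator (fun y => ‖φ y‖ ^ 2) y = (0 : ℝ → ℝ) y ∧
        φ y = s * B.ψ |y|}ᶜ := by
    rintro y ⟨hy1, hy2⟩ ⟨hy, hy'⟩
    have hy0 : 0 < y := hb.trans hy1
    rw [indicator_of_mem (show y ∈ {y : ℝ | b ≤ |y|} by
      rw [mem_ofPred_eq, abs_of_pos hy0]; exact hy1.le), hy', abs_of_pos hy0] at hy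
    have hne : B.ψ y ≠ 0 := hball (by rw [Real.dist_eq, abs_of_pos] <;> linarith)
    have : s * B.ψ y = 0 := by simpa using hy
    exact mul_ne_zero hs0 hne this
  have hvol := measure_mono_null hsub (mem_ae_iff.1 (hz.and hφ))
  rw [Real.volume_Ioo, ENNReal.ofReal_eq_zero] at hvol
  linarith

end HalfLineBasis

/-! ### The dispersion relation -/

/-- Infinitely many wavenumbers must be excluded on one neighbourhood. Monotonicity in `k` reduces
this to the two neighbours of `kstar`, for which strict inequality persists by continuity. -/
theorem eventually_dispersion_eq_imp {P : ℕ → ℝ → ℝ} {kstar : ℕ} {t₀ : ℝ} (ht₀ : 0 < t₀)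
    (hanti : ∀ t, 0 < t → ∀ j k, 1 ≤ j → j < k → P k t < P j t)
    (hinj : ∀ s t, 0 < s → 0 < t → P kstar s = P kstar t → s = t) (hk : 1 ≤ kstar)
    (hcont : ∀ k, 1 ≤ k → ContinuousAt (P k) t₀) :
    ∀ᶠ t in 𝓝 t₀, ∀ k, 1 ≤ k → P k t = P kstar t₀ → k = kstar ∧ t = t₀ := by
  have up : ∀ᶠ t in 𝓝 t₀, P (kstar + 1) t < P kstar t₀ :=
    (hcont _ (by omega)).eventually_lt_const (hanti t₀ ht₀ _ _ hk (Nat.lt_succ_self _))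
  -- For `kstar = 1` there is no smaller wavenumber, and the guard keeps `kstar - 1` from being 0.
  have down : ∀ᶠ t in 𝓝 t₀, 2 ≤ kstar → P kstar t₀ < P (kstar - 1) t := by
    by_cases h2 : 2 ≤ kstar
    · filter_upwards [(hcont (kstar - 1) (by omega)).eventually_const_lt
        (hanti t₀ ht₀ (kstar - 1) kstar (by omega) (by omega))] with t h _ using h
    · exact Eventually.of_forall fun t h => absurd h h2
  filter_upwards [up, down, eventually_gt_nhds ht₀] with t h1 h2 h3 k hk1 he
  rcases lt_trichotomy k kstar with hlt | rfl | hlt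
  · have h4 := h2 (by omega)
    rcases (show k ≤ kstar - 1 by omega).eq_or_lt with rfl | h5
    · linarith
    · have := hanti t h3 k (kstar - 1) hk1 h5
      linarith
  · exact ⟨rfl, hinj t t₀ h3 ht₀ he⟩
  · rcases (show kstar + 1 ≤ k by omega).eq_or_lt with rfl | h5
    · linarith
    · have := hanti t h3 (kstar + 1) k (by omega) h5
      linarith

/-! ### The step potential -/

theorem measurable_stepCoeff (b m μ : ℝ) : Measurable (stepCoeff b m μ) :=
  Measurable.ite (measurableSet_le (by fun_prop) (by fun_prop)) measurable_const measurable_const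

theorem stepCoeff_neg (b m μ y : ℝ) : stepCoeff b m μ (-y) = stepCoeff b m μ y := by
  simp [stepCoeff]

theorem abs_stepCoeff_le (b m μ y : ℝ) : |stepCoeff b m μ y| ≤ |μ ^ 2| + |m| := by
  unfold stepCoeff
  split_ifs
  · linarith [abs_nonneg m]
  · linarith [abs_nonneg (μ ^ 2)]

theorem waveCoeff_step (b β : ℝ) (k : ℕ) {lam : ℝ} (h : lam < 1) :
    waveCoeff ({y : ℝ | b ≤ |y|}.indicator 1) (fun y => β * {y : ℝ | |y| < b}.indicator 1 y) k lam =
      stepCoeff b ((k : ℝ) ^ 2 * (1 - β)) (k * √(1 - lam)) := by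
  ext y
  unfold waveCoeff stepCoeff
  beta_reduce
  by_cases hy : b ≤ |y|
  · rw [indicator_of_mem (by exact hy), indicator_of_notMem (show y ∉ {y : ℝ | |y| < b} from not_lt.2 hy), if_pos hy,
      mul_pow, Real.sq_sqrt (by linarith)]
    simp
  · rw [indicator_of_notMem (by exact hy), indicator_of_mem (show y ∈ {y : ℝ | |y| < b} from not_le.1 hy), if_neg hy]
    simp

theorem regularDistribution_apply {g : ℝ → ℝ} (hg : LocallyIntegrable g)
    (f : TestFunction (⊤ : TopologicalSpace.Opens ℝ) ℝ ⊤) :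
    regularDistribution g f = ∫ y, f y * g y :=
  TestFunction.integralAgainstBilinCLM_eq_integral (hg.locallyIntegrableOn _)

theorem regularDistribution_const_mul (β : ℝ) {g : ℝ → ℝ} (hg : LocallyIntegrable g) :
    regularDistribution (fun y => β * g y) = β • regularDistribution g := by
  have hβ : LocallyIntegrable fun y => β * g y := hg.smul β
  ext f
  refine (regularDistribution_apply hβ f).trans ?_
  change _ = β • regularDistribution g f
  rw [regularDistribution_apply hg, smul_eq_mul, ← integral_const_mul]
  congr 1
  ext y
  ring

theorem memLp_top_indicator_one {s : Set ℝ} (hs : MeasurableSet s) :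
    MemLp (s.indicator (1 : ℝ → ℝ)) ∞ volume :=
  MemLp.indicator hs (memLp_top_const (1 : ℝ))

/-- The hypotheses of the existence theorem for a step potential whose dispersion relation is
`α = 2 P k √(1 - λ)`. -/
theorem existenceHypotheses_of_dispersion (γ : ℝ) {β b α lamstar : ℝ} {kstar : ℕ}
    (hk : 1 ≤ kstar) (hlam : lamstar < 1) (hb : 0 < b) (P : ℕ → ℝ → ℝ) (C S : ℕ → ℝ → ℝ)
    (hC : ∀ k : ℕ, 1 ≤ k → ∀ y, HasDerivAt (C k) ((k : ℝ) ^ 2 * (1 - β) * S k y) y)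
    (hS : ∀ k : ℕ, 1 ≤ k → ∀ y, HasDerivAt (S k) (C k y) y)
    (hC0 : ∀ k : ℕ, 1 ≤ k → C k 0 = 1) (hS0 : ∀ k : ℕ, 1 ≤ k → S k 0 = 0)
    (hW : ∀ k : ℕ, 1 ≤ k → C k b ^ 2 - (k : ℝ) ^ 2 * (1 - β) * S k b ^ 2 = 1)
    (hN : ∀ k : ℕ, 1 ≤ k → ∀ t, 0 < t → C k b + k * t * S k b ≠ 0)
    (hP : ∀ k : ℕ, 1 ≤ k → ∀ t, 0 < t →
      ((k : ℝ) ^ 2 * (1 - β) * S k b + k * t * C k b) / (C k b + k * t * S k b) = k ^ 2 * P k t)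
    (hpos : ∀ k : ℕ, 1 ≤ k → ∀ t, 0 < t → 0 < P k t)
    (hanti : ∀ t, 0 < t → ∀ j k, 1 ≤ j → j < k → P k t < P j t)
    (hinj : ∀ s t, 0 < s → 0 < t → P kstar s = P kstar t → s = t)
    (hcont : ∀ k : ℕ, 1 ≤ k → ∀ t, 0 < t → ContinuousAt (P k) t)
    (hα : α = 2 * P kstar √(1 - lamstar))
    (hbound : ∃ M, ∀ k : ℕ, 1 ≤ k → ∀ t, 0 < t → t < 2 * √(1 - lamstar) → ∀ y, 0 ≤ y → y ≤ b →
      |C k y - (k : ℝ) ^ 2 * P k t * S k y| ≤ M) :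
    0 < b ∧ 0 < α ∧ ExistenceHypotheses (γ • delta0) (stepPotential β b α) kstar lamstar := by
  set t₀ := √(1 - lamstar) with ht₀def
  have ht₀ : 0 < t₀ := Real.sqrt_pos.2 (by linarith)
  refine ⟨hb, by rw [hα]; linarith [hpos kstar hk t₀ ht₀], ?_⟩
  obtain ⟨M, hM⟩ := hbound
  have hmeas₁ : MeasurableSet {y : ℝ | b ≤ |y|} := measurableSet_le (by fun_prop) (by fun_prop)
  have hmeas₂ : MeasurableSet {y : ℝ | |y| < b} := measurableSet_lt (by fun_prop) (by fun_prop)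
  have hsq : ContinuousAt (fun lam : ℝ => √(1 - lam)) lamstar := by fun_prop
  -- On this ball `lam < 1`, the dispersion relation has no further solution, and t₀/2 < √(1 - lam)
  -- < 2t₀. The lower bound gives a uniform decay rate, the upper one is the range of `hbound`.
  obtain ⟨δ, hδ, hball⟩ := Metric.eventually_nhds_iff.1
    ((eventually_lt_nhds hlam).and ((hsq.eventually
      (eventually_dispersion_eq_imp ht₀ hanti hinj hk fun k hk => hcont k hk t₀ ht₀)).and
      ((hsq.eventually_const_lt (show t₀ / 2 < √(1 - lamstar) by linarith)).and
        (hsq.eventually_lt_const (show √(1 - lamstar) < 2 * t₀ by linarith)))))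
  set V₀ : ℝ → ℝ := {y : ℝ | b ≤ |y|}.indicator 1 with hV₀
  set W : ℝ → ℝ := fun y => β * {y : ℝ | |y| < b}.indicator 1 y with hWdef
  have basis (k : ℕ) (hk1 : 1 ≤ k) (lam : ℝ) (hl : lam ∈ Metric.ball lamstar δ) :
      ∃ B : HalfLineBasis (waveCoeff V₀ W k lam), B.slope = -((k : ℝ) ^ 2 * P k √(1 - lam)) ∧
        B.ψ b ≠ 0 ∧ ∀ y, 0 ≤ y →
          ‖B.ψ y‖ ≤ M * Real.exp (t₀ / 2 * b) * Real.exp (-(t₀ / 2) * y) := by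
    obtain ⟨hl1, -, hl2, hl3⟩ := hball hl
    have ht : 0 < √(1 - lam) := by linarith
    have hkpos : (1 : ℝ) ≤ k := by exact_mod_cast hk1
    rw [waveCoeff_step b β k hl1]
    obtain ⟨B, B1, B2, B3, B4⟩ := exists_stepBasis hb
      (by positivity : 0 < (k : ℝ) * √(1 - lam)) (hC k hk1) (hS k hk1) (hC0 k hk1) (hS0 k hk1)
      (hW k hk1) (hN k hk1 _ ht) rfl
    rw [hP k hk1 _ ht] at B1 B3 B4
    have hMb (y : ℝ) (hy : 0 ≤ y) (hyb : y ≤ b) :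
        |C k y + -((k : ℝ) ^ 2 * P k √(1 - lam)) * S k y| ≤ M := by
      have := hM k hk1 _ ht hl3 y hy hyb
      rwa [neg_mul, ← sub_eq_add_neg]
    have hM0 : 0 ≤ M := (abs_nonneg _).trans (hMb 0 le_rfl hb.le)
    refine ⟨B, B1, B2, fun y hy => ?_⟩
    -- The majorant is M exp(t₀(b - y)/2): at least `M` on [0,b], and beyond `b` it decays no faster
    -- than the mode, since k ≥ 1 gives k√(1 - lam) ≥ t₀/2.
    rw [mul_assoc, ← Real.exp_add]
    rcases le_total y b with hyb | hyb
    · rw [B3 y hyb, Complex.norm_real, Real.norm_eq_abs]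
      refine (hMb y hy hyb).trans (le_mul_of_one_le_right hM0 (Real.one_le_exp ?_))
      nlinarith
    · rw [B4 y hyb, Complex.norm_real, Real.norm_eq_abs, abs_mul, abs_of_pos (Real.exp_pos _)]
      refine mul_le_mul (hMb b hb.le le_rfl) (Real.exp_le_exp.2 ?_) (Real.exp_pos _).le hM0
      have : t₀ / 2 ≤ k * √(1 - lam) := by nlinarith
      nlinarith
  have hq (k : ℕ) (lam : ℝ) (hl : lam ∈ Metric.ball lamstar δ) :
      (∀ y, waveCoeff V₀ W k lam (-y) = waveCoeff V₀ W k lam y) ∧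
      Measurable (waveCoeff V₀ W k lam) ∧ ∃ K : ℝ, ∀ y, |waveCoeff V₀ W k lam y| ≤ K := by
    rw [waveCoeff_step b β k (hball hl).1]
    exact ⟨stepCoeff_neg _ _ _, measurable_stepCoeff _ _ _, _, abs_stepCoeff_le _ _ _⟩
  have hstar : lamstar ∈ Metric.ball lamstar δ := Metric.mem_ball_self hδ
  -- The same ball serves as both intervals `I` and `J`.
  refine ⟨γ, α, V₀, W, rfl, fun lam => ?_, ⟨memLp_top_indicator_one hmeas₁,
    (memLp_top_indicator_one hmeas₂).const_mul β, fun y => ?_, fun y => ?_⟩,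
    Metric.ball lamstar δ, Metric.ball lamstar δ, ⟨?_, ?_⟩, ⟨Metric.isOpen_ball, ?_, Subset.rfl,
    hstar, ?_, ?_⟩, ?_, ?_⟩
  · rw [hWdef, regularDistribution_const_mul β
      ((memLp_top_indicator_one hmeas₂).locallyIntegrable le_top)]
    rfl
  · simp [hV₀, indicator]
  · simp [hWdef, indicator]
  · exact (convex_ball lamstar δ).ordConnected
  · intro k hk1 lam hl
    obtain ⟨B, B1, -, -⟩ := basis k hk1 lam hl
    obtain ⟨q1, q2, K, q3⟩ := hq k lam hl
    refine B.zero_mem_resolvent_regularOp q1 q2 q3 ?_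
    have hkpos : (1 : ℝ) ≤ k := by exact_mod_cast hk1
    have := hpos k hk1 (√(1 - lam)) (by linarith [(hball hl).2.2.1])
    rw [B1]
    exact neg_ne_zero.2 (by positivity)
  · exact (convex_ball lamstar δ).ordConnected
  · obtain ⟨B, B1, -, -⟩ := basis kstar hk lamstar hstar
    obtain ⟨q1, q2, K, q3⟩ := hq kstar lamstar hstar
    exact B.zeroIsIsolatedSimpleEigenvalue_deltaOp q1 q2 q3 (by rw [B1, hα]; ring)
  · intro k hk1 lam hl hne
    obtain ⟨B, B1, -, -⟩ := basis k hk1 lam hl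
    obtain ⟨q1, q2, K, q3⟩ := hq k lam hl
    refine B.zero_mem_resolvent_deltaOp q1 q2 q3 fun h0 => hne ?_
    have hkpos : (1 : ℝ) ≤ k := by exact_mod_cast hk1
    have hk2 : (k : ℝ) ^ 2 ≠ 0 := by positivity
    -- After cancelling `k²`, criticality of the operator is the dispersion relation.
    have e : P k √(1 - lam) = P kstar t₀ := by
      rw [B1, hα] at h0
      refine mul_left_cancel₀ hk2 ?_
      linarith
    obtain ⟨e1, e2⟩ := (hball hl).2.1 k hk1 e
    have e3 : 1 - lam = 1 - lamstar :=
      (Real.sqrt_inj (by linarith [(hball hl).1]) (by linarith)).1 e2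
    rw [e1, show lam = lamstar by linarith]
  -- One square integrable majorant for all `k` and `lam`; the 1 added to its norm below only makes
  -- the constant positive.
  · set F : ℝ → ℂ := fun y =>
      ((M * Real.exp (t₀ / 2 * b) * Real.exp (-(t₀ / 2) * y) : ℝ) : ℂ) with hF
    have mF : MemLp F 2 (volume.restrict (Ioi 0)) := by
      refine memLp_two_of_norm_le_exp (by fun_prop) (M := |M * Real.exp (t₀ / 2 * b)|)
        (half_pos ht₀) fun y _ => ?_
      rw [hF, Complex.norm_real, Real.norm_eq_abs, abs_mul, abs_of_pos (Real.exp_pos (_ * y))]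
    refine ⟨(eLpNorm F 2 (volume.restrict (Ioi 0))).toReal + 1, by positivity,
      fun k hk1 lam hl => ?_⟩
    obtain ⟨B, -, -, B3⟩ := basis k hk1 lam hl
    obtain ⟨-, q2, K, q3⟩ := hq k lam hl
    refine ⟨⟨B.ψ, B.isDecayingMode_ψ q2 q3⟩, fun φ hφ => ?_⟩
    rw [eLpNorm_congr_ae (B.ae_eq_ψ_of_isDecayingMode hφ)]
    calc _ ≤ eLpNorm F 2 (volume.restrict (Ioi 0)) := by
          refine eLpNorm_mono_ae ?_
          filter_upwards [ae_restrict_mem measurableSet_Ioi] with y hy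
          refine (B3 y (le_of_lt hy)).trans ?_
          rw [hF, Complex.norm_real, Real.norm_eq_abs]
          exact le_abs_self _
      _ = ENNReal.ofReal (eLpNorm F 2 (volume.restrict (Ioi 0))).toReal :=
          (ENNReal.ofReal_toReal mF.2.ne).symm
      _ ≤ _ := ENNReal.ofReal_le_ofReal (by linarith)
  · intro φ hφ
    obtain ⟨B, B1, B2, -⟩ := basis kstar hk lamstar hstar
    obtain ⟨q1, q2, K, q3⟩ := hq kstar lamstar hstar
    refine B.integral_indicator_mul_norm_sq_ne_zero hb B2 ?_
    rw [← hφ]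
    exact (B.kernel_deltaOp q1 q2 q3 (by rw [B1, hα]; ring)).symm

/-! ### The three cases -/

/-- The width is chosen so that kσb = kπ with σ = √(β - 1): the sine vanishes at `b` for every `k`,
the inner interval transmits the outer slope -kt unchanged, and P_k(t) = t/k. -/
theorem existenceHypotheses_oscillatory (γ : ℝ) {β b α lamstar : ℝ} {kstar : ℕ}
    (hk : 1 ≤ kstar) (hlam : lamstar < 1) (hβ : 1 < β) (hb : b = Real.pi / √(β - 1))
    (hα : α = 2 * √(1 - lamstar) / kstar) :
    0 < b ∧ 0 < α ∧ ExistenceHypotheses (γ • delta0) (stepPotential β b α) kstar lamstar := by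
  set σ := √(β - 1) with hσ
  have hσ0 : 0 < σ := Real.sqrt_pos.2 (by linarith)
  have hσ2 : σ ^ 2 = β - 1 := Real.sq_sqrt (by linarith)
  have kp {k : ℕ} (h : 1 ≤ k) : (0 : ℝ) < k := by exact_mod_cast h
  have hb0 : 0 < b := by rw [hb]; exact div_pos Real.pi_pos hσ0
  have hsin (k : ℕ) : Real.sin (k * σ * b) = 0 := by
    rw [hb, show (k : ℝ) * σ * (Real.pi / σ) = k * Real.pi by field_simp]
    exact Real.sin_nat_mul_pi k
  have hcos (k : ℕ) : Real.cos (k * σ * b) ^ 2 = 1 := by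
    have := Real.sin_sq_add_cos_sq (k * σ * b)
    rw [hsin] at this
    linarith
  have hcos0 (k : ℕ) : Real.cos (k * σ * b) ≠ 0 := fun h => by
    have := hcos k
    rw [h] at this
    norm_num at this
  have lin (k : ℕ) (y : ℝ) : HasDerivAt (fun y => (k : ℝ) * σ * y) (k * σ) y := by
    simpa using (hasDerivAt_id y).const_mul ((k : ℝ) * σ)
  refine existenceHypotheses_of_dispersion γ hk hlam hb0 (fun k t => t / k)
    (fun k y => Real.cos (k * σ * y)) (fun k y => Real.sin (k * σ * y) / (k * σ))
    ?_ ?_ ?_ ?_ ?_ ?_ ?_ ?_ ?_ ?_ ?_ ?_ ?_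
  · intro k hk1 y
    have hk0 := kp hk1
    refine (lin k y).cos.congr_deriv ?_
    rw [show 1 - β = -σ ^ 2 by linarith]
    field_simp
  · intro k hk1 y
    have hk0 := kp hk1
    refine ((lin k y).sin.div_const _).congr_deriv ?_
    field_simp
  · intro k _; simp
  · intro k _; simp
  · intro k _; simp [hsin, hcos]
  · intro k _ t _; simp [hsin, hcos0]
  · intro k hk1 t _
    have hk0 := kp hk1
    have := hcos0 k
    simp only [hsin, zero_div, mul_zero, zero_add, add_zero]
    field_simp
  · intro k hk1 t ht
    exact div_pos ht (kp hk1)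
  · intro t ht j k hj hjk
    exact div_lt_div_of_pos_left ht (kp hj) (by exact_mod_cast hjk)
  · intro s t _ _ h
    have := (kp hk).ne'
    field_simp at h
    exact h
  · intro k _ t _
    fun_prop
  · rw [hα]; ring
  -- On [0,b] the mode is cos(kσy) - (t/σ) sin(kσy), with t < 2√(1 - lamstar).
  · refine ⟨1 + 2 * √(1 - lamstar) / σ, fun k hk1 t ht ht2 y _ _ => ?_⟩
    have hk0 := kp hk1
    have e : (k : ℝ) ^ 2 * (t / k) * (Real.sin (k * σ * y) / (k * σ)) =
        t / σ * Real.sin (k * σ * y) := by field_simp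
    rw [e]
    refine (abs_sub _ _).trans (add_le_add (Real.abs_cos_le_one _) ?_)
    rw [abs_mul, abs_of_pos (div_pos ht hσ0)]
    calc _ ≤ t / σ * 1 := mul_le_mul_of_nonneg_left (Real.abs_sin_le_one _) (by positivity)
      _ ≤ _ := by rw [mul_one]; gcongr

/-- Solutions are affine on [0,b]; the mode is (1 + tk(b - y))/(1 + tkb) there, hence between 0 and
1. -/
theorem existenceHypotheses_linear (γ : ℝ) {b α lamstar : ℝ} {kstar : ℕ}
    (hk : 1 ≤ kstar) (hlam : lamstar < 1) (hb : 0 < b)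
    (hα : α = 2 * √(1 - lamstar) / (kstar * (1 + √(1 - lamstar) * kstar * b))) :
    0 < b ∧ 0 < α ∧ ExistenceHypotheses (γ • delta0) (stepPotential 1 b α) kstar lamstar := by
  have kp {k : ℕ} (h : 1 ≤ k) : (0 : ℝ) < k := by exact_mod_cast h
  have dp {k : ℕ} (h : 1 ≤ k) {t : ℝ} (ht : 0 < t) : 0 < k * (1 + t * k * b) := by
    have := kp h
    positivity
  refine existenceHypotheses_of_dispersion γ hk hlam hb (fun k t => t / (k * (1 + t * k * b)))
    (fun _ _ => 1) (fun _ y => y) ?_ ?_ ?_ ?_ ?_ ?_ ?_ ?_ ?_ ?_ ?_ ?_ ?_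
  · intro k _ y
    simpa using hasDerivAt_const y (1 : ℝ)
  · intro k _ y
    exact hasDerivAt_id y
  · intro k _; rfl
  · intro k _; rfl
  · intro k _; simp
  · intro k hk1 t ht
    have := kp hk1
    positivity
  · intro k hk1 t ht
    have := kp hk1
    have : 0 < 1 + k * t * b := by positivity
    have : 0 < 1 + t * k * b := by positivity
    field_simp
    ring
  · intro k hk1 t ht
    exact div_pos ht (dp hk1 ht)
  · intro t ht j k hj hjk
    have hjk' : (j : ℝ) < k := by exact_mod_cast hjk
    have := kp hj
    refine div_lt_div_of_pos_left ht (dp hj ht) ?_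
    gcongr
  · intro s t hs ht h
    have h1 := kp hk
    have h2 := dp hk hs
    have h3 := dp hk ht
    rw [div_eq_div_iff h2.ne' h3.ne'] at h
    refine mul_left_cancel₀ h1.ne' ?_
    linear_combination h
  · intro k hk1 t ht
    exact ContinuousAt.div (by fun_prop) (by fun_prop) (dp hk1 ht).ne'
  · rw [hα]; ring
  · refine ⟨1, fun k hk1 t ht _ y hy hyb => ?_⟩
    have hk0 := kp hk1
    have hd : 0 < 1 + t * k * b := by positivity
    have e : (1 : ℝ) - (k : ℝ) ^ 2 * (t / (k * (1 + t * k * b))) * y =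
        (1 + t * k * (b - y)) / (1 + t * k * b) := by
      field_simp
      ring
    have h1 : 0 ≤ t * k * (b - y) := mul_nonneg (by positivity) (by linarith)
    have h2 : 0 ≤ t * k * y := by positivity
    rw [e, abs_of_nonneg (by positivity), div_le_one hd]
    linarith

/-- Monotonicity in the wavenumber, with x = kσb made continuous. With s = sinh x and c = cosh x the
numerator of the derivative is (σ² - t²)x - σt(c² + s²) - (σ² + t²)sc, negative because x ≤ s ≤ sc.
-/
theorem strictAntiOn_hyperbolic {σ t : ℝ} (hσ : 0 < σ) (ht : 0 < t) :
    StrictAntiOn (fun x => (σ * Real.sinh x + t * Real.cosh x) /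
      ((σ * Real.cosh x + t * Real.sinh x) * x)) (Ioi 0) := by
  have dpos {x : ℝ} (hx : 0 < x) : 0 < σ * Real.cosh x + t * Real.sinh x := by
    have := Real.cosh_pos x
    have := Real.sinh_pos_iff.2 hx
    positivity
  have hd (x : ℝ) (hx : 0 < x) : HasDerivAt (fun x => (σ * Real.sinh x + t * Real.cosh x) /
      ((σ * Real.cosh x + t * Real.sinh x) * x))
      (((σ * Real.cosh x + t * Real.sinh x) * ((σ * Real.cosh x + t * Real.sinh x) * x) -
        (σ * Real.sinh x + t * Real.cosh x) * ((σ * Real.sinh x + t * Real.cosh x) * x +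
          (σ * Real.cosh x + t * Real.sinh x) * 1)) /
        ((σ * Real.cosh x + t * Real.sinh x) * x) ^ 2) x :=
    (((Real.hasDerivAt_sinh x).const_mul σ).add ((Real.hasDerivAt_cosh x).const_mul t)).div
      ((((Real.hasDerivAt_cosh x).const_mul σ).add
        ((Real.hasDerivAt_sinh x).const_mul t)).mul (hasDerivAt_id x)) (mul_pos (dpos hx) hx).ne'
  refine strictAntiOn_of_deriv_neg (convex_Ioi 0)
    (fun x hx => (hd x hx).continuousAt.continuousWithinAt) fun x hx => ?_
  rw [interior_Ioi] at hx
  have hx0 : 0 < x := hx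
  rw [(hd x hx).deriv]
  refine div_neg_of_neg_of_pos ?_ (pow_pos (mul_pos (dpos hx0) hx0) 2)
  have hs : x ≤ Real.sinh x := Real.self_le_sinh_iff.2 hx0.le
  have hs0 : 0 < Real.sinh x := Real.sinh_pos_iff.2 hx0
  have hc : 1 ≤ Real.cosh x := Real.one_le_cosh x
  have hcs := Real.cosh_sq x
  set s := Real.sinh x
  set c := Real.cosh x
  have h1 : x ≤ s * c := hs.trans (le_mul_of_one_le_right hs0.le hc)
  have h2 : (σ ^ 2 + t ^ 2) * x ≤ (σ ^ 2 + t ^ 2) * (s * c) :=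
    mul_le_mul_of_nonneg_left h1 (by positivity)
  have h3 : 0 < σ * t * (c ^ 2 + s ^ 2) := by positivity
  have h4 : 0 ≤ t ^ 2 * x := by positivity
  have e : (σ * c + t * s) * ((σ * c + t * s) * x) -
      (σ * s + t * c) * ((σ * s + t * c) * x + (σ * c + t * s) * 1) =
      (σ ^ 2 - t ^ 2) * x - (σ * t * (c ^ 2 + s ^ 2) + (σ ^ 2 + t ^ 2) * (s * c)) := by
    linear_combination (σ ^ 2 - t ^ 2) * x * hcs
  rw [e]
  linarith

/-- P_k is σ²b times the function of `strictAntiOn_hyperbolic` at kσb, which gives monotonicity in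
k. In t it is a Möbius map whose determinant is a nonzero multiple of cosh² - sinh² = 1, hence
injective. -/
theorem existenceHypotheses_hyperbolic (γ : ℝ) {β b α lamstar : ℝ} {kstar : ℕ}
    (hk : 1 ≤ kstar) (hlam : lamstar < 1) (hβ : β < 1) (hb : 0 < b)
    (hα : α = 2 * √(1 - β) / kstar *
      ((√(1 - β) * Real.sinh (kstar * √(1 - β) * b) +
          √(1 - lamstar) * Real.cosh (kstar * √(1 - β) * b)) /
        (√(1 - β) * Real.cosh (kstar * √(1 - β) * b) +
          √(1 - lamstar) * Real.sinh (kstar * √(1 - β) * b)))) :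
    0 < b ∧ 0 < α ∧ ExistenceHypotheses (γ • delta0) (stepPotential β b α) kstar lamstar := by
  set σ := √(1 - β) with hσ
  have hσ0 : 0 < σ := Real.sqrt_pos.2 (by linarith)
  have hσ2 : σ ^ 2 = 1 - β := Real.sq_sqrt (by linarith)
  have kp {k : ℕ} (h : 1 ≤ k) : (0 : ℝ) < k := by exact_mod_cast h
  have sp {k : ℕ} (h : 1 ≤ k) : 0 < Real.sinh (k * σ * b) :=
    Real.sinh_pos_iff.2 (by have := kp h; positivity)
  have cp (x : ℝ) : 0 < Real.cosh x := Real.cosh_pos x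
  have np {k : ℕ} (h : 1 ≤ k) {t : ℝ} (ht : 0 < t) :
      0 < σ * Real.sinh (k * σ * b) + t * Real.cosh (k * σ * b) := by
    have := sp h
    have := cp (k * σ * b)
    positivity
  have dp {k : ℕ} (h : 1 ≤ k) {t : ℝ} (ht : 0 < t) :
      0 < σ * Real.cosh (k * σ * b) + t * Real.sinh (k * σ * b) := by
    have := sp h
    have := cp (k * σ * b)
    positivity
  have lin (k : ℕ) (y : ℝ) : HasDerivAt (fun y => (k : ℝ) * σ * y) (k * σ) y := by
    simpa using (hasDerivAt_id y).const_mul ((k : ℝ) * σ)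
  refine existenceHypotheses_of_dispersion γ hk hlam hb
    (fun k t => σ / k * ((σ * Real.sinh (k * σ * b) + t * Real.cosh (k * σ * b)) /
      (σ * Real.cosh (k * σ * b) + t * Real.sinh (k * σ * b))))
    (fun k y => Real.cosh (k * σ * y)) (fun k y => Real.sinh (k * σ * y) / (k * σ))
    ?_ ?_ ?_ ?_ ?_ ?_ ?_ ?_ ?_ ?_ ?_ ?_ ?_
  · intro k hk1 y
    have hk0 := kp hk1
    refine (lin k y).cosh.congr_deriv ?_
    rw [← hσ2]
    field_simp
  · intro k hk1 y
    have hk0 := kp hk1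
    refine ((lin k y).sinh.div_const _).congr_deriv ?_
    field_simp
  · intro k _; simp
  · intro k _; simp
  · intro k hk1
    have hk0 := kp hk1
    rw [Real.cosh_sq, ← hσ2]
    field_simp
    ring
  · intro k hk1 t ht
    have := kp hk1
    have := sp hk1
    have := cp (k * σ * b)
    positivity
  · intro k hk1 t ht
    have hk0 := kp hk1
    have hd := dp hk1 ht
    have e : Real.cosh (k * σ * b) + k * t * (Real.sinh (k * σ * b) / (k * σ)) =
        (σ * Real.cosh (k * σ * b) + t * Real.sinh (k * σ * b)) / σ := by field_simp
    rw [e, ← hσ2]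
    field_simp
  · intro k hk1 t ht
    exact mul_pos (div_pos hσ0 (kp hk1)) (div_pos (np hk1 ht) (dp hk1 ht))
  · intro t ht j k hj hjk
    have hjk' : (j : ℝ) < k := by exact_mod_cast hjk
    have hj0 := kp hj
    have hk0 : (0 : ℝ) < k := hj0.trans hjk'
    have h := strictAntiOn_hyperbolic hσ0 ht (show (j : ℝ) * σ * b ∈ Ioi 0 by
      simp only [mem_Ioi]; positivity) (show (k : ℝ) * σ * b ∈ Ioi 0 by
      simp only [mem_Ioi]; positivity) (by gcongr)
    have e (i : ℕ) (hi : 1 ≤ i) : σ / i * ((σ * Real.sinh (i * σ * b) + t * Real.cosh (i * σ * b)) /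
        (σ * Real.cosh (i * σ * b) + t * Real.sinh (i * σ * b))) = σ ^ 2 * b *
        ((σ * Real.sinh (i * σ * b) + t * Real.cosh (i * σ * b)) /
        ((σ * Real.cosh (i * σ * b) + t * Real.sinh (i * σ * b)) * (i * σ * b))) := by
      have := kp hi
      have := dp hi ht
      field_simp
    rw [e j hj, e k (hj.trans hjk.le)]
    exact mul_lt_mul_of_pos_left h (by positivity)
  · intro s t hs ht h
    have h0 : σ / kstar ≠ 0 := (div_pos hσ0 (kp hk)).ne'
    have h1 := mul_left_cancel₀ h0 h
    rw [div_eq_div_iff (dp hk hs).ne' (dp hk ht).ne'] at h1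
    refine mul_left_cancel₀ hσ0.ne' ?_
    linear_combination h1 + (σ * t - σ * s) * Real.cosh_sq (kstar * σ * b)
  · intro k hk1 t ht
    exact ContinuousAt.mul continuousAt_const
      (ContinuousAt.div (by fun_prop) (by fun_prop) (dp hk1 ht).ne')
  · rw [hα]; ring
  · refine ⟨1, fun k hk1 t ht _ y hy hyb => ?_⟩
    have hk0 := kp hk1
    have hd := dp hk1 ht
    -- By the addition formulas the mode depends on b - y through increasing functions, so on [0,b]
    -- it lies between 0 and its value 1 at the origin.
    have e : Real.cosh (k * σ * y) - (k : ℝ) ^ 2 * (σ / k *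
        ((σ * Real.sinh (k * σ * b) + t * Real.cosh (k * σ * b)) /
        (σ * Real.cosh (k * σ * b) + t * Real.sinh (k * σ * b)))) *
        (Real.sinh (k * σ * y) / (k * σ)) =
        (σ * Real.cosh (k * σ * b - k * σ * y) + t * Real.sinh (k * σ * b - k * σ * y)) /
        (σ * Real.cosh (k * σ * b) + t * Real.sinh (k * σ * b)) := by
      rw [Real.cosh_sub, Real.sinh_sub]
      field_simp
      ring
    have hkσ : 0 < k * σ := mul_pos hk0 hσ0
    have h1 : 0 ≤ k * σ * b - k * σ * y := by nlinarith
    have h2 : k * σ * b - k * σ * y ≤ k * σ * b := by nlinarith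
    have h3 := Real.sinh_nonneg_iff.2 h1
    have h4 := Real.sinh_le_sinh.2 h2
    have h5 : Real.cosh (k * σ * b - k * σ * y) ≤ Real.cosh (k * σ * b) := by
      rw [Real.cosh_le_cosh, abs_of_nonneg h1, abs_of_nonneg (h1.trans h2)]
      exact h2
    have h6 := cp (k * σ * b - k * σ * y)
    rw [e, abs_of_nonneg (by positivity), div_le_one hd]
    gcongr

end TravelingWave

end

theorem corollary2p11 (γ β b α lamstar : ℝ) (kstar : ℕ) (hk : 1 ≤ kstar) (hlam : lamstar < 1)
    (hcase :
      (1 < β ∧ b = Real.pi / √(β - 1) ∧ α = 2 * √(1 - lamstar) / kstar) ∨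
      (β < 1 ∧ 0 < b ∧
        α = 2 * √(1 - β) / kstar *
          ((√(1 - β) * Real.sinh (kstar * √(1 - β) * b) +
              √(1 - lamstar) * Real.cosh (kstar * √(1 - β) * b)) /
            (√(1 - β) * Real.cosh (kstar * √(1 - β) * b) +
              √(1 - lamstar) * Real.sinh (kstar * √(1 - β) * b)))) ∨
      (β = 1 ∧ 0 < b ∧
        α = 2 * √(1 - lamstar) / (kstar * (1 + √(1 - lamstar) * kstar * b)))) :
    0 < b ∧ 0 < α ∧
      TravelingWave.ExistenceHypotheses (γ • TravelingWave.delta0)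
        (TravelingWave.stepPotential β b α) kstar lamstar := by
  rcases hcase with ⟨hβ, hb, hα⟩ | ⟨hβ, hb, hα⟩ | ⟨rfl, hb, hα⟩
  · exact TravelingWave.existenceHypotheses_oscillatory γ hk hlam hβ hb hα
  · exact TravelingWave.existenceHypotheses_hyperbolic γ hk hlam hβ hb hα
  · exact TravelingWave.existenceHypotheses_linear γ hk hlam hb hα
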